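/- For a hypersurface $\Sigma\subset\mathbb{R}^n$ let $|\Sigma|$ be its area, $r$ the distance to the origin, and $\omega_{n-1}$ the area of the unit sphere $\mathbb{S}^{n-1}$. Consider the inequalities $$\text{(3)}\quad \int_\Sigma r\,d\Sigma\ \ge\ \omega_{n-1}\left(\frac{|\Sigma|}{\omega_{n-1}}\right)^{\frac{n}{n-1}},\qquad \text{(5)}\quad \int_\Sigma r^2\,d\Sigma\ \ge\ \omega_{n-1}\left(\frac{|\Sigma|}{\omega_{n-1}}\right)^{\frac{n+1}{n-1}}.$$ The plane curve $$x(t)=(\cos 3t+9)\sin t-3\sin 3t\cos t,\qquad y(t)=(\cos 3t+9)\cos t+3\sin 3t\sin t,\qquad 0\le t\le 2\pi,$$ is the boundary of a compact convex set with non-empty interior and has constant width $18$. Let $\Sigma\subset\mathbb{R}^3$ be the surface obtained by rotating it about the $y$-axis, this axis becoming the third coordinate axis of $\mathbb{R}^3$. Then: 1. $\Sigma=\{(x(t)\cos s,\;x(t)\sin s,\;y(t)) : 0\le t\le\pi,\ 0\le s\le 2\pi\}$, and $\Sigma$ is a compact, connected, embedded real-analytic surface which is star-shaped (the graph of a positive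 continuous function over a sphere centred at some point). 2. $\Sigma$ is strictly convex: it is the boundary of a compact strictly convex set with non-empty interior. With respect to the outward unit normal its principal curvatures at the point with parameters $(t,s)$, $0\le t\le \pi$, belonging to two orthogonal principal directions, are $$\kappa_1=\frac{1}{\sqrt{(9-8\cos 3t)^2}},\qquad \kappa_2=\frac{8\cos 3t-9}{(8\cos^3 t-9)\sqrt{(9-8\cos 3t)^2}},$$ and every principal curvature of $\Sigma$ lies in $[1/17,\,1]$. 3. The functions $r$ and $r^2$ are integrable on $\Sigma$, and $$|\Sigma|^2=\frac{122855056\,\pi^2}{1225},\qquad \int_\Sigma r^2\,d\Sigma=\frac{124744936\,\pi}{5005},$$ $$|\Sigma|^{-2}\int_\Sigma r^2\,d\Sigma=\frac{545759095}{2196034126\,\pi}<\frac1{4\pi}=\frac{1}{\omega_2}.$$ 4. For $n=3$ and this $\Sigma$ both inequalities (3) and (5) are false. -/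

import Mathlib

open Set Filter Topology MeasureTheory
open scoped MeasureTheory

noncomputable section

namespace SmallMoment

/-- Euclidean space `ℝⁿ`. -/
abbrev E (n : ℕ) : Type := EuclideanSpace ℝ (Fin n)

/-! ### Area, polar moment of inertia and the two inequalities for hypersurfaces of `ℝⁿ` -/

/-- The area (`(n-1)`-dimensional volume) of a hypersurface of `ℝⁿ`, `n ≥ 2`. Here `μHE[d]` is the
`d`-dimensional Hausdorff measure normalized so that it agrees with Lebesgue measure on `ℝᵈ`. -/
def area (n : ℕ) (S : Set (E n)) : ℝ := (μHE[n - 1] S).toReal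

/-- `ω_{n-1}`, the area of the unit sphere of `ℝⁿ`. -/
def unitSphereArea (n : ℕ) : ℝ := area n (Metric.sphere 0 1)

/-- `∫_S r`, with `r` the distance to the origin. -/
def firstMoment (n : ℕ) (S : Set (E n)) : ℝ := ∫ x in S, ‖x‖ ∂μHE[n - 1]

/-- `∫_S r²`, the polar moment of inertia. -/
def polarMoment (n : ℕ) (S : Set (E n)) : ℝ := ∫ x in S, ‖x‖ ^ 2 ∂μHE[n - 1]

/-- `∫_S r ≥ ω_{n-1} (|S| / ω_{n-1})^{n/(n-1)}`. -/
def FirstMomentInequality (n : ℕ) (S : Set (E n)) : Prop :=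
  firstMoment n S ≥
    unitSphereArea n * (area n S / unitSphereArea n) ^ ((n : ℝ) / ((n : ℝ) - 1))

/-- `∫_S r² ≥ ω_{n-1} (|S| / ω_{n-1})^{(n+1)/(n-1)}`. -/
def PolarMomentInequality (n : ℕ) (S : Set (E n)) : Prop :=
  polarMoment n S ≥
    unitSphereArea n * (area n S / unitSphereArea n) ^ (((n : ℝ) + 1) / ((n : ℝ) - 1))

/-! ### Plane curves of constant width -/

/-- `C` is a closed curve of constant width `w`: the boundary of a compact convex set with interior
points, any two parallel supporting lines of which are at distance `w`. -/
def IsConstantWidthCurve (C : Set (E 2)) (w : ℝ) : Prop :=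
  ∃ K : Set (E 2), IsCompact K ∧ Convex ℝ K ∧ (interior K).Nonempty ∧ frontier K = C ∧
    ∀ u : E 2, ‖u‖ = 1 → ∃ a b : ℝ,
      IsGreatest ((fun x => inner ℝ u x) '' K) a ∧ IsLeast ((fun x => inner ℝ u x) '' K) b ∧
        a - b = w

/-! ### Surfaces in `ℝ³` -/

/-- `S` is an embedded real analytic surface: around each of its points it has a local
parametrization that is analytic, immersive, and a homeomorphism onto an open piece of `S`. -/
def IsAnalyticSurface (S : Set (E 3)) : Prop :=
  ∀ p ∈ S, ∃ (U : Set (E 2)) (V : Set (E 3)) (X : E 2 → E 3) (Y : E 3 → E 2),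
    IsOpen U ∧ IsOpen V ∧ p ∈ V ∧ AnalyticOnNhd ℝ X U ∧
    (∀ u ∈ U, Function.Injective (fderiv ℝ X u)) ∧
    X '' U = S ∩ V ∧ ContinuousOn Y (S ∩ V) ∧ ∀ u ∈ U, Y (X u) = u

/-- `S` is the graph of a positive (continuous) function over a sphere centred at some point. -/
def IsStarShaped (S : Set (E 3)) : Prop :=
  ∃ (p : E 3) (ρ : E 3 → ℝ), ContinuousOn ρ (Metric.sphere 0 1) ∧
    (∀ θ ∈ Metric.sphere (0 : E 3) 1, 0 < ρ θ) ∧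
    S = (fun θ => p + ρ θ • θ) '' Metric.sphere 0 1

/-- `v` is the velocity at `p` of a curve in `S` through `p`. -/
def IsTangentVector (S : Set (E 3)) (p v : E 3) : Prop :=
  ∃ γ : ℝ → E 3, (∀ᶠ τ in 𝓝 0, γ τ ∈ S) ∧ γ 0 = p ∧ HasDerivAt γ v 0

/-- `N` restricts to the continuous outward unit normal field of the boundary of `K`. -/
def IsOutwardUnitNormal (K : Set (E 3)) (N : E 3 → E 3) : Prop :=
  ContinuousOn N (frontier K) ∧
  ∀ p ∈ frontier K, ‖N p‖ = 1 ∧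
    (∀ v, IsTangentVector (frontier K) p v → inner ℝ (N p) v = 0) ∧
    ∀ᶠ ε in 𝓝[>] (0 : ℝ), p + ε • N p ∉ K ∧ p - ε • N p ∈ interior K

/-- `v ≠ 0` is a principal direction at `p`, with principal curvature `κ`, of the surface `S` with
unit normal field `N`: `v` is tangent to `S` at `p` and `dN_p(v) = κ v`. (With the outward
normal, a sphere of radius `R` has principal curvatures `1 / R`.) -/
def IsPrincipal (S : Set (E 3)) (N : E 3 → E 3) (p : E 3) (κ : ℝ) (v : E 3) : Prop :=
  v ≠ 0 ∧ ∃ γ : ℝ → E 3, (∀ᶠ τ in 𝓝 0, γ τ ∈ S) ∧ γ 0 = p ∧ HasDerivAt γ v 0 ∧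
    HasDerivAt (fun τ => N (γ τ)) (κ • v) 0

/-! ### The example -/

/-- The abscissa of the generating curve. -/
def curveX (t : ℝ) : ℝ :=
  (Real.cos (3 * t) + 9) * Real.sin t - 3 * Real.sin (3 * t) * Real.cos t

/-- The ordinate of the generating curve. -/
def curveY (t : ℝ) : ℝ :=
  (Real.cos (3 * t) + 9) * Real.cos t + 3 * Real.sin (3 * t) * Real.sin t

/-- The generating curve. -/
def curve : Set (E 2) := (fun t : ℝ => !₂[curveX t, curveY t]) '' Icc 0 (2 * Real.pi)

/-- The set obtained by rotating a plane set about its second coordinate axis, which becomes the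
third coordinate axis of `ℝ³`. -/
def rotate (C : Set (E 2)) : Set (E 3) :=
  {p | ∃ q ∈ C, ∃ s : ℝ, p = !₂[q 0 * Real.cos s, q 0 * Real.sin s, q 1]}

/-- The surface of the example. -/
def surface : Set (E 3) := rotate curve

/-- The parametrization of the surface by the parameter `t` of the curve and the angle `s`. -/
def param (t s : ℝ) : E 3 := !₂[curveX t * Real.cos s, curveX t * Real.sin s, curveY t]

/-- The principal curvature along the meridians. -/
def kappa₁ (t : ℝ) : ℝ := 1 / √((9 - 8 * Real.cos (3 * t)) ^ 2)

/-- The principal curvature along the parallels. -/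
def kappa₂ (t : ℝ) : ℝ :=
  (8 * Real.cos (3 * t) - 9) /
    ((8 * Real.cos t ^ 3 - 9) * √((9 - 8 * Real.cos (3 * t)) ^ 2))

end SmallMoment

end

/-! ### Area formula for injective Lipschitz immersions -/

namespace AreaFormula

open Metric Module
open scoped NNReal ENNReal

/-! The curve and the surface are treated together as boundaries of one convex body with support
function `h(ν) = 9 + 4c³ - 3c`, where `c = ⟪e, ν⟫` and `e` is the unit axis; this is `9 + cos 3t` at
angle `t` from `e`. The gradient of the 1-homogeneous extension of `h` is the inverse Gauss map
`boundaryPoint e`. The odd terms cancel in `h(ν) + h(-ν) = 18`, which is the constant width.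

All the convex geometry rests on one two-sided estimate: the gap `h(ν) - ⟪x(μ), ν⟫`, with `x(μ)` the
boundary point of normal `μ`, lies between `1 - ⟪μ, ν⟫` and `17 (1 - ⟪μ, ν⟫)`. So at every boundary
point a unit ball touches from inside and a ball of radius 17 from outside. Both bounds are
instances of the trigonometric inequality `support_gap_aux`. The inner ball makes the Gauss map well
defined and 1-Lipschitz, and makes the charts immersive; the outer ball gives one contact point per
supporting hyperplane, hence `frontier_body` and `strictConvex_body`. Applied to difference
quotients, the two bounds confine the principal curvatures to `[1/17, 1]`. The explicit curvatures
are reciprocals of eigenvalues of the differential of the inverse Gauss map.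

For the measures, an area formula is obtained by differentiating the pulled-back Hausdorff measure
with respect to Lebesgue measure (`restrict_image_eq_map_withDensity`). For a surface of revolution
it gives `integral_revolution`, and `x = cos t` turns the area and the polar moment into integrals
of polynomials over `[-1, 1]`.

A round sphere centred at the origin gives equality in both inequalities. Here the polar moment is
below `|Σ|²/(4π)` by about 0.6 percent, which refutes (5) since its exponent is 2 for `n = 3`.
Cauchy–Schwarz, `(∫ r)² ≤ |Σ| ∫ r²`, carries the failure over to (3). -/

/-- A right inverse `j` of `g` on `g '' s` makes `f ∘ j` Lipschitz there. The hypothesis forces `f`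
to identify any points that `g` identifies, so `f ∘ j` has image `f '' s` even when `g` is not
injective. -/
theorem euclideanHausdorffMeasure_image_le {X Y Z : Type*} [EMetricSpace Y] [EMetricSpace Z]
    [MeasurableSpace Y] [BorelSpace Y] [MeasurableSpace Z] [BorelSpace Z]
    {f : X → Y} {g : X → Z} {s : Set X} {K : ℝ≥0}
    (h : ∀ x ∈ s, ∀ y ∈ s, edist (f x) (f y) ≤ K * edist (g x) (g y)) (d : ℕ) :
    μHE[d] (f '' s) ≤ (K : ℝ≥0∞) ^ d * μHE[d] (g '' s) := by
  rcases s.eq_empty_or_nonempty with rfl | ⟨x₀, hx₀⟩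
  · simp
  have : Nonempty X := ⟨x₀⟩
  set j := Function.invFunOn g s
  have hj : ∀ x ∈ s, j (g x) ∈ s ∧ g (j (g x)) = g x := fun x hx =>
    ⟨Function.invFunOn_mem ⟨x, hx, rfl⟩, Function.invFunOn_eq ⟨x, hx, rfl⟩⟩
  have hL : LipschitzOnWith K (f ∘ j) (g '' s) := by
    rintro _ ⟨x, hx, rfl⟩ _ ⟨y, hy, rfl⟩
    have := h _ (hj x hx).1 _ (hj y hy).1
    rwa [(hj x hx).2, (hj y hy).2] at this
  have himg : f '' s = (f ∘ j) '' (g '' s) := by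
    rw [image_image]
    refine image_congr fun x hx => ?_
    have := h _ hx _ (hj x hx).1
    rw [(hj x hx).2, edist_self, mul_zero, nonpos_iff_eq_zero, edist_eq_zero] at this
    exact this
  have := hL.hausdorffMeasure_image_le (d := d) (Nat.cast_nonneg d)
  rw [himg, Measure.euclideanHausdorffMeasure_def, Measure.euclideanHausdorffMeasure_def,
    Measure.smul_apply, Measure.smul_apply, ENNReal.smul_def, ENNReal.smul_def, smul_eq_mul,
    smul_eq_mul, mul_left_comm]
  gcongr
  simpa using this

variable {V W : Type*} [NormedAddCommGroup V] [InnerProductSpace ℝ V] [FiniteDimensional ℝ V]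
  [NormedAddCommGroup W] [InnerProductSpace ℝ W]

/-- An injective linear map on a finite-dimensional space is bounded below, so the strict-derivative
error, small relative to `‖y - z‖`, is also small relative to `‖L y - L z‖`. -/
theorem eventually_norm_sub_mem_Icc {F : V → W} {L : V →L[ℝ] W} {x : V}
    (hF : HasStrictFDerivAt F L x) (hL : Function.Injective L) {η : ℝ} (hη : 0 < η) :
    ∃ r > 0, ∀ y ∈ ball x r, ∀ z ∈ ball x r,
      (1 - η) * ‖L y - L z‖ ≤ ‖F y - F z‖ ∧ ‖F y - F z‖ ≤ (1 + η) * ‖L y - L z‖ := by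
  obtain ⟨K, hK0, hK⟩ := L.toLinearMap.exists_antilipschitzWith
    (LinearMap.ker_eq_bot.2 hL)
  have hKp : (0 : ℝ) < K := by exact_mod_cast hK0
  have h1 := hF.isLittleO.def (div_pos hη hKp)
  rw [nhds_prod_eq, Filter.eventually_prod_self_iff'] at h1
  obtain ⟨s, hs, h1⟩ := h1
  obtain ⟨r, hr, hrs⟩ := Metric.mem_nhds_iff.1 hs
  refine ⟨r, hr, fun y hy z hz => ?_⟩
  have h2 : ‖F y - F z - L (y - z)‖ ≤ η / K * ‖y - z‖ := h1 y (hrs hy) z (hrs hz)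
  have h3 : ‖y - z‖ ≤ K * ‖L y - L z‖ := by
    have := hK.le_mul_dist y z
    simpa [dist_eq_norm] using this
  have h4 : ‖F y - F z - (L y - L z)‖ ≤ η * ‖L y - L z‖ := by
    rw [← map_sub]
    rw [← map_sub] at h3
    calc _ ≤ η / K * ‖y - z‖ := h2
      _ ≤ η / K * (K * ‖L (y - z)‖) := by gcongr
      _ = _ := by field_simp
  have h5 := norm_sub_norm_le (F y - F z) (L y - L z)
  have h6 := norm_sub_norm_le (L y - L z) (F y - F z)
  rw [norm_sub_rev (L y - L z) (F y - F z)] at h6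
  constructor <;> linarith

variable [MeasurableSpace V] [BorelSpace V] [MeasurableSpace W] [BorelSpace W]

/-- On small balls `F` and `L` distort distances alike up to factors `1 ± η`, so the measures of the
images agree up to `(1 ± η) ^ d`; for the linear map the ratio is exactly the Jacobian. -/
theorem tendsto_measure_image_closedBall_div {F : V → W} {L : V →L[ℝ] W} {x : V}
    (hF : HasStrictFDerivAt F L x) (hL : Function.Injective L) :
    Tendsto (fun r => μHE[finrank ℝ V] (F '' closedBall x r) / volume (closedBall x r)) (𝓝[>] 0)
      (𝓝 (ENNReal.ofReal L.toLinearMap.normDet)) := by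
  set J := ENNReal.ofReal L.toLinearMap.normDet
  set d := finrank ℝ V
  have hJ : J ≠ ∞ := ENNReal.ofReal_ne_top
  have hlin : ∀ s : Set V, μHE[d] (L '' s) = J * volume s := fun s =>
    L.toLinearMap.euclideanHausdorffMeasure_image_eq_normDet_mul_volume s
  have key : ∀ η : ℝ, 0 < η → η < 1 → ∀ᶠ r in 𝓝[>] (0 : ℝ),
      ENNReal.ofReal (1 - η) ^ d * J ≤ μHE[d] (F '' closedBall x r) / volume (closedBall x r) ∧
      μHE[d] (F '' closedBall x r) / volume (closedBall x r) ≤ ENNReal.ofReal (1 + η) ^ d * J := by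
    intro η hη hη1
    obtain ⟨r₀, hr₀, h⟩ := eventually_norm_sub_mem_Icc hF hL hη
    filter_upwards [Ioo_mem_nhdsGT hr₀] with r hr
    have hsub : closedBall x r ⊆ ball x r₀ := closedBall_subset_ball hr.2
    have hv0 : volume (closedBall x r) ≠ 0 := (measure_closedBall_pos _ _ hr.1).ne'
    have hvt : volume (closedBall x r) ≠ ∞ := measure_closedBall_lt_top.ne
    constructor
    · rw [ENNReal.le_div_iff_mul_le (Or.inl hv0) (Or.inl hvt), mul_assoc, ← hlin]
      have h1 : μHE[d] (L '' closedBall x r) ≤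
          ((Real.toNNReal (1 - η)⁻¹ : ℝ≥0) : ℝ≥0∞) ^ d * μHE[d] (F '' closedBall x r) := by
        refine euclideanHausdorffMeasure_image_le (fun y hy z hz => ?_) d
        have := (h y (hsub hy) z (hsub hz)).1
        rw [edist_dist, edist_dist, dist_eq_norm, dist_eq_norm]
        change _ ≤ ENNReal.ofReal _ * _
        rw [← ENNReal.ofReal_mul (inv_nonneg.2 (by linarith))]
        refine ENNReal.ofReal_le_ofReal ?_
        rw [inv_mul_eq_div, le_div_iff₀ (by linarith)]
        linarith
      calc _ ≤ ENNReal.ofReal (1 - η) ^ d * (ENNReal.ofReal ((1 - η)⁻¹) ^ d *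
            μHE[d] (F '' closedBall x r)) := by gcongr; exact h1
        _ = _ := by
          rw [← mul_assoc, ← mul_pow, ← ENNReal.ofReal_mul (by linarith),
            mul_inv_cancel₀ (by linarith)]
          simp
    · rw [ENNReal.div_le_iff hv0 hvt, mul_assoc, ← hlin]
      refine euclideanHausdorffMeasure_image_le (K := Real.toNNReal (1 + η)) (fun y hy z hz => ?_) d
      have := (h y (hsub hy) z (hsub hz)).2
      rw [edist_dist, edist_dist, dist_eq_norm, dist_eq_norm]
      change _ ≤ ENNReal.ofReal _ * _
      rw [← ENNReal.ofReal_mul (by linarith)]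
      exact ENNReal.ofReal_le_ofReal this
  have hc : ∀ σ : ℝ, Tendsto (fun η : ℝ => ENNReal.ofReal (1 + σ * η) ^ d * J) (𝓝[>] 0) (𝓝 J) := by
    intro σ
    have h1 : Tendsto (fun η : ℝ => ENNReal.ofReal (1 + σ * η) ^ d) (𝓝[>] 0) (𝓝 1) := by
      have : Continuous (fun η : ℝ => ENNReal.ofReal (1 + σ * η) ^ d) := by
        have : Continuous (fun η : ℝ => ENNReal.ofReal (1 + σ * η)) :=
          ENNReal.continuous_ofReal.comp (by fun_prop)
        exact (ENNReal.continuous_pow d).comp this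
      have h2 := this.tendsto 0
      simp only [mul_zero, add_zero, ENNReal.ofReal_one, one_pow] at h2
      exact h2.mono_left nhdsWithin_le_nhds
    simpa using ENNReal.Tendsto.mul_const h1 (Or.inr hJ)
  refine tendsto_order.2 ⟨fun a ha => ?_, fun a ha => ?_⟩
  · obtain ⟨η, h1, h2⟩ := (((hc (-1)).eventually (lt_mem_nhds ha)).and
      (Ioo_mem_nhdsGT one_pos)).exists
    filter_upwards [key η h2.1 h2.2] with r hr
    refine h1.trans_le ?_
    simpa [sub_eq_add_neg] using hr.1
  · obtain ⟨η, h1, h2⟩ := (((hc 1).eventually (gt_mem_nhds ha)).and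
      (Ioo_mem_nhdsGT one_pos)).exists
    filter_upwards [key η h2.1 h2.2] with r hr
    refine lt_of_le_of_lt ?_ h1
    simpa using hr.2

/-- The area formula for an injective Lipschitz immersion: the Hausdorff measure on the image is the
push-forward of Lebesgue measure weighted by the Jacobian. -/
theorem restrict_image_eq_map_withDensity [CompleteSpace W] [SecondCountableTopology W]
    {F : V → W} {F' : V → V →L[ℝ] W} {U : Set V} {K : ℝ≥0}
    (hU : IsOpen U) (hinj : InjOn F U) (hlip : LipschitzOnWith K F U)
    (hF : ∀ x ∈ U, HasStrictFDerivAt F (F' x) x) (hF' : ∀ x ∈ U, Function.Injective (F' x))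
    (hFm : Measurable F) :
    (μHE[finrank ℝ V] : Measure W).restrict (F '' U) =
      Measure.map F ((volume.restrict U).withDensity
        fun x => ENNReal.ofReal (F' x).toLinearMap.normDet) := by
  set d := finrank ℝ V
  have hemb : MeasurableEmbedding (U.domRestrict F) :=
    hlip.continuousOn.measurableEmbedding hU.measurableSet hinj
  -- `ρ` is the Hausdorff measure of the image pulled back to `V`. The Lipschitz bound makes it
  -- absolutely continuous, and Besicovitch differentiation identifies its density with the limit of
  -- ratios on shrinking balls.
  set ρ : Measure V := ((μHE[d] : Measure W).comap (U.domRestrict F)).map Subtype.val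
  have hρ : ∀ s, MeasurableSet s → ρ s = μHE[d] (F '' (s ∩ U)) := by
    intro s hs
    rw [Measure.map_apply measurable_subtype_coe hs, hemb.comap_apply]
    congr 1
    ext y
    simp only [mem_image, Subtype.exists, mem_preimage, mem_inter_iff, domRestrict_apply]
    aesop
  have hρle : ρ ≤ (K ^ d) • volume := by
    refine Measure.le_iff.2 fun s hs => ?_
    rw [hρ s hs, Measure.smul_apply, ENNReal.smul_def, smul_eq_mul]
    have h1 := euclideanHausdorffMeasure_image_le (f := F) (g := id) (s := s ∩ U) (K := K)
      (fun x hx y hy => hlip hx.2 hy.2) d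
    rw [image_id, InnerProductSpace.euclideanHausdorffMeasure_eq_volume] at h1
    push_cast
    exact h1.trans (by gcongr; exact inter_subset_left)
  have hac : ρ ≪ volume := (Measure.absolutelyContinuous_of_le hρle).trans
    (Measure.smul_absolutelyContinuous)
  have : IsLocallyFiniteMeasure ρ := Measure.isLocallyFiniteMeasure_of_le hρle
  have hdens : ∀ᵐ x ∂(volume.restrict U),
      ρ.rnDeriv volume x = ENNReal.ofReal (F' x).toLinearMap.normDet := by
    rw [ae_restrict_iff' hU.measurableSet]
    filter_upwards [Besicovitch.ae_tendsto_rnDeriv ρ volume] with x hx hxU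
    refine tendsto_nhds_unique hx
      ((tendsto_measure_image_closedBall_div (hF x hxU) (hF' x hxU)).congr' ?_)
    obtain ⟨r₀, hr₀, hsub⟩ := Metric.isOpen_iff.1 hU x hxU
    filter_upwards [Ioo_mem_nhdsGT hr₀] with r hr
    rw [hρ _ measurableSet_closedBall,
      inter_eq_left.2 ((closedBall_subset_ball hr.2).trans hsub)]
  have hρU : ρ.restrict U = ρ := by
    refine Measure.restrict_eq_self_of_ae_mem ?_
    rw [ae_iff]
    change ρ Uᶜ = 0
    rw [hρ _ hU.measurableSet.compl]
    simp
  have hρeq : ρ = (volume.restrict U).withDensity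
      fun x => ENNReal.ofReal (F' x).toLinearMap.normDet := by
    rw [← withDensity_congr_ae hdens, ← restrict_withDensity hU.measurableSet,
      Measure.withDensity_rnDeriv_eq _ _ hac, hρU]
  rw [← hρeq]
  refine Measure.ext fun s hs => ?_
  rw [Measure.map_apply hFm hs, hρ _ (hFm hs), Measure.restrict_apply hs, inter_comm,
    image_preimage_inter, inter_comm]

end AreaFormula

namespace SmallMoment

open Metric
open scoped RealInnerProductSpace

/-! ### The convex body with support function `9 + 4 ν³ - 3 ν` about an axis -/

section Body

variable {V : Type*} [NormedAddCommGroup V] [InnerProductSpace ℝ V]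

/-- The support function, which is `9 + cos 3t` at angle `t` from the axis `e`. -/
noncomputable def supportFn (e ν : V) : ℝ := 9 + 4 * ⟪e, ν⟫ ^ 3 - 3 * ⟪e, ν⟫

/-- The point of the boundary with outward unit normal `ν`. -/
noncomputable def boundaryPoint (e ν : V) : V :=
  (9 - 8 * ⟪e, ν⟫ ^ 3) • ν + (12 * ⟪e, ν⟫ ^ 2 - 3) • e

/-- The convex body with support function `supportFn e`. -/
def body (e : V) : Set V := {x | ∀ ν ∈ sphere (0 : V) 1, ⟪x, ν⟫ ≤ supportFn e ν}

/-- The outward unit normal on the boundary of `body e`. -/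
noncomputable def gaussMap (e : V) : V → V :=
  Function.invFunOn (boundaryPoint e) (sphere 0 1)

theorem inner_boundaryPoint (e μ ν : V) :
    ⟪boundaryPoint e μ, ν⟫ =
      (9 - 8 * ⟪e, μ⟫ ^ 3) * ⟪μ, ν⟫ + (12 * ⟪e, μ⟫ ^ 2 - 3) * ⟪e, ν⟫ := by
  rw [boundaryPoint, inner_add_left, real_inner_smul_left, real_inner_smul_left]

theorem inner_boundaryPoint_self (e : V) {ν : V} (hν : ν ∈ sphere (0 : V) 1) :
    ⟪boundaryPoint e ν, ν⟫ = supportFn e ν := by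
  rw [mem_sphere_zero_iff_norm] at hν
  rw [inner_boundaryPoint, supportFn, real_inner_self_eq_norm_sq, hν]
  ring

/-- The coefficient of `p` is nonpositive, so the worst case is `p = c * d + a * b`, where both
normals are coplanar with the axis. There the expression factors into two nonnegative terms. -/
theorem support_gap_aux {a b c d p : ℝ} (ha : a ^ 2 = 1 - c ^ 2) (hb : b ^ 2 = 1 - d ^ 2)
    (hp : p ≤ c * d + a * b) : 0 ≤ 8 + 4 * d ^ 3 - 12 * c ^ 2 * d - 8 * (1 - c ^ 3) * p := by
  -- With `c = cos α`, `a = sin α`, `d = cos β`, `b = sin β`, these are `P = cos (α - β)` and `q =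
  -- cos (2α + β)`.
  set P := c * d + a * b with hP
  set q := (2 * c ^ 2 - 1) * d - 2 * a * c * b with hq
  have hP1 : P ^ 2 ≤ 1 := by
    have : P ^ 2 + (a * d - c * b) ^ 2 = 1 := by
      rw [hP]; linear_combination (d ^ 2 + b ^ 2) * ha + hb
    nlinarith [sq_nonneg (a * d - c * b)]
  have hq1 : q ^ 2 ≤ 1 := by
    have : q ^ 2 + (2 * a * c * d + (2 * c ^ 2 - 1) * b) ^ 2 = 1 := by
      rw [hq]; linear_combination (4 * c ^ 2 * (b ^ 2 + d ^ 2)) * ha + hb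
    nlinarith [sq_nonneg (2 * a * c * d + (2 * c ^ 2 - 1) * b)]
  have hc : c ^ 3 ≤ 1 := by
    have : c ≤ 1 := by nlinarith [sq_nonneg a]
    nlinarith [sq_nonneg (c + 1), sq_nonneg c]
  have h1 : 0 ≤ 4 * (1 - P) * (2 - (1 + P) * q) := by
    have h2 := abs_le.1 ((sq_le_one_iff_abs_le_one P).1 hP1)
    have h3 := abs_le.1 ((sq_le_one_iff_abs_le_one q).1 hq1)
    have : (1 + P) * q ≤ 2 := by nlinarith
    exact mul_nonneg (by linarith) (by linarith)
  have h4 : 8 + 4 * d ^ 3 - 12 * c ^ 2 * d - 8 * (1 - c ^ 3) * P =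
      4 * (1 - P) * (2 - (1 + P) * q) := by
    rw [hP, hq]
    grind
  nlinarith [mul_le_mul_of_nonneg_left hp (by linarith : 0 ≤ 8 * (1 - c ^ 3))]

/-- Cauchy–Schwarz for the components of `μ` and `ν` orthogonal to `e`, whose norms are `a` and `b`.
-/
theorem exists_inner_le {e μ ν : V} (he : ‖e‖ = 1) (hμ : μ ∈ sphere (0 : V) 1)
    (hν : ν ∈ sphere (0 : V) 1) :
    ∃ a b : ℝ, a ^ 2 = 1 - ⟪e, μ⟫ ^ 2 ∧ b ^ 2 = 1 - ⟪e, ν⟫ ^ 2 ∧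
      ⟪μ, ν⟫ ≤ ⟪e, μ⟫ * ⟪e, ν⟫ + a * b := by
  rw [mem_sphere_zero_iff_norm] at hμ hν
  have key : ∀ x : V, ‖x‖ = 1 → ‖x - ⟪e, x⟫ • e‖ ^ 2 = 1 - ⟪e, x⟫ ^ 2 := by
    intro x hx
    rw [norm_sub_sq_real, hx, norm_smul, he, real_inner_smul_right, real_inner_comm, mul_one,
      Real.norm_eq_abs, sq_abs]
    ring
  refine ⟨_, _, key μ hμ, key ν hν, ?_⟩
  have := real_inner_le_norm (μ - ⟪e, μ⟫ • e) (ν - ⟪e, ν⟫ • e)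
  rw [inner_sub_left, inner_sub_right, inner_sub_right, real_inner_smul_left,
    real_inner_smul_left, real_inner_smul_right, real_inner_smul_right, real_inner_self_eq_norm_sq,
    he, real_inner_comm e μ] at this
  linarith

/-- The body contains the unit ball touching its boundary at `boundaryPoint e μ`. -/
theorem one_sub_inner_le_support_gap {e μ ν : V} (he : ‖e‖ = 1) (hμ : μ ∈ sphere (0 : V) 1)
    (hν : ν ∈ sphere (0 : V) 1) :
    1 - ⟪μ, ν⟫ ≤ supportFn e ν - ⟪boundaryPoint e μ, ν⟫ := by
  obtain ⟨a, b, ha, hb, hp⟩ := exists_inner_le he hμ hν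
  rw [inner_boundaryPoint, supportFn]
  linarith [support_gap_aux ha hb hp]

/-- The body is contained in the ball of radius `17` touching its boundary at
`boundaryPoint e μ`. -/
theorem support_gap_le {e μ ν : V} (he : ‖e‖ = 1) (hμ : μ ∈ sphere (0 : V) 1)
    (hν : ν ∈ sphere (0 : V) 1) :
    supportFn e ν - ⟪boundaryPoint e μ, ν⟫ ≤ 17 * (1 - ⟪μ, ν⟫) := by
  obtain ⟨a, b, ha, hb, hp⟩ := exists_inner_le he hμ hν
  rw [inner_boundaryPoint, supportFn]
  -- Constant width at work: the upper bound with constant `17 = 18 - 1` is the lower bound with the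
  -- signs of both heights reversed.
  have := support_gap_aux (a := a) (b := b) (c := -⟪e, μ⟫) (d := -⟪e, ν⟫) (p := ⟪μ, ν⟫)
    (by rw [ha]; ring) (by rw [hb]; ring) (by linarith)
  linarith

theorem norm_sub_sq_of_mem_sphere {μ ν : V} (hμ : μ ∈ sphere (0 : V) 1)
    (hν : ν ∈ sphere (0 : V) 1) : ‖μ - ν‖ ^ 2 = 2 * (1 - ⟪μ, ν⟫) := by
  rw [mem_sphere_zero_iff_norm] at hμ hν
  rw [norm_sub_sq_real, hμ, hν]
  ring

/-- Adding the lower gap bounds for `(μ, ν)` and `(ν, μ)` gives strong monotonicity of the inverse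
Gauss map. -/
theorem norm_sub_sq_le_inner {e μ ν : V} (he : ‖e‖ = 1) (hμ : μ ∈ sphere (0 : V) 1)
    (hν : ν ∈ sphere (0 : V) 1) :
    ‖μ - ν‖ ^ 2 ≤ ⟪boundaryPoint e μ - boundaryPoint e ν, μ - ν⟫ := by
  have h1 := one_sub_inner_le_support_gap he hμ hν
  have h2 := one_sub_inner_le_support_gap he hν hμ
  rw [norm_sub_sq_of_mem_sphere hμ hν, inner_sub_left, inner_sub_right, inner_sub_right,
    inner_boundaryPoint_self e hμ, inner_boundaryPoint_self e hν]
  rw [real_inner_comm] at h2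
  linarith

theorem norm_sub_le_norm_boundaryPoint_sub {e μ ν : V} (he : ‖e‖ = 1)
    (hμ : μ ∈ sphere (0 : V) 1) (hν : ν ∈ sphere (0 : V) 1) :
    ‖μ - ν‖ ≤ ‖boundaryPoint e μ - boundaryPoint e ν‖ := by
  have h1 := (norm_sub_sq_le_inner he hμ hν).trans (real_inner_le_norm _ _)
  rcases (norm_nonneg (μ - ν)).eq_or_lt with h | h
  · rw [← h]; exact norm_nonneg _
  · rw [sq] at h1
    exact le_of_mul_le_mul_right h1 h

theorem injOn_boundaryPoint {e : V} (he : ‖e‖ = 1) :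
    InjOn (boundaryPoint e) (sphere (0 : V) 1) := by
  intro μ hμ ν hν h
  have := norm_sub_le_norm_boundaryPoint_sub he hμ hν
  rw [h, sub_self, norm_zero] at this
  exact sub_eq_zero.1 (norm_le_zero_iff.1 this)

theorem gaussMap_boundaryPoint {e ν : V} (he : ‖e‖ = 1) (hν : ν ∈ sphere (0 : V) 1) :
    gaussMap e (boundaryPoint e ν) = ν :=
  (injOn_boundaryPoint he).leftInvOn_invFunOn hν

theorem continuous_boundaryPoint (e : V) : Continuous (boundaryPoint e) := by
  unfold boundaryPoint
  fun_prop

theorem continuous_supportFn (e : V) : Continuous (supportFn e) := by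
  unfold supportFn
  fun_prop

theorem continuousOn_gaussMap {e : V} (he : ‖e‖ = 1) :
    ContinuousOn (gaussMap e) (boundaryPoint e '' sphere 0 1) := by
  refine LipschitzOnWith.continuousOn (K := 1) (LipschitzOnWith.of_dist_le_mul ?_)
  rintro _ ⟨μ, hμ, rfl⟩ _ ⟨ν, hν, rfl⟩
  rw [gaussMap_boundaryPoint he hμ, gaussMap_boundaryPoint he hν, dist_eq_norm, dist_eq_norm]
  simpa using norm_sub_le_norm_boundaryPoint_sub he hμ hν

theorem abs_inner_le_one {e ν : V} (he : ‖e‖ = 1) (hν : ν ∈ sphere (0 : V) 1) :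
    |⟪e, ν⟫| ≤ 1 := by
  rw [mem_sphere_zero_iff_norm] at hν
  simpa [he, hν] using abs_real_inner_le_norm e ν

theorem supportFn_mem_Icc {e ν : V} (he : ‖e‖ = 1) (hν : ν ∈ sphere (0 : V) 1) :
    supportFn e ν ∈ Icc (8 : ℝ) 10 := by
  obtain ⟨h1, h2⟩ := abs_le.1 (abs_inner_le_one he hν)
  rw [supportFn]
  constructor
  -- `4c³ - 3c + 1 = (c + 1)(2c - 1)²`, and symmetrically for the upper bound.
  · nlinarith [mul_nonneg (by linarith : 0 ≤ ⟪e, ν⟫ + 1) (sq_nonneg (2 * ⟪e, ν⟫ - 1))]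
  · nlinarith [mul_nonneg (by linarith : 0 ≤ 1 - ⟪e, ν⟫) (sq_nonneg (2 * ⟪e, ν⟫ + 1))]

theorem supportFn_add_supportFn_neg (e ν : V) : supportFn e ν + supportFn e (-ν) = 18 := by
  rw [supportFn, supportFn, inner_neg_right]
  ring

theorem boundaryPoint_mem_body {e μ : V} (he : ‖e‖ = 1) (hμ : μ ∈ sphere (0 : V) 1) :
    boundaryPoint e μ ∈ body e := by
  intro ν hν
  have h1 := one_sub_inner_le_support_gap he hμ hν
  have h2 := norm_sub_sq_of_mem_sphere hμ hν
  nlinarith [sq_nonneg ‖μ - ν‖]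

/-- The body lies in a ball of radius 17 touching the supporting hyperplane at `boundaryPoint e ν`.
A second contact point would differ by some `z` orthogonal to `ν`, and testing the support
inequality in a direction tilted from `ν` towards `z` forces `z = 0`. -/
theorem eq_boundaryPoint_of_inner_eq {e x ν : V} (he : ‖e‖ = 1) (hx : x ∈ body e)
    (hν : ν ∈ sphere (0 : V) 1) (h : ⟪x, ν⟫ = supportFn e ν) : x = boundaryPoint e ν := by
  set z := x - boundaryPoint e ν with hz
  have hzν : ⟪z, ν⟫ = 0 := by
    rw [hz, inner_sub_left, h, inner_boundaryPoint_self e hν, sub_self]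
  have key : ∀ w : V, w ≠ 0 → ⟪z, w⟫ ≤ 17 * (‖w‖ - ⟪ν, w⟫) := by
    intro w hw
    have hw' : 0 < ‖w‖ := norm_pos_iff.2 hw
    have hμ : ‖w‖⁻¹ • w ∈ sphere (0 : V) 1 := by
      rw [mem_sphere_zero_iff_norm, norm_smul, norm_inv, norm_norm, inv_mul_cancel₀ hw'.ne']
    have h1 := hx _ hμ
    have h2 := support_gap_le he hν hμ
    have h3 : ⟪z, ‖w‖⁻¹ • w⟫ ≤ 17 * (1 - ⟪ν, ‖w‖⁻¹ • w⟫) := by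
      rw [hz, inner_sub_left]; linarith
    rw [real_inner_smul_right, real_inner_smul_right] at h3
    calc ⟪z, w⟫ = ‖w‖ * (‖w‖⁻¹ * ⟪z, w⟫) := by field_simp
      _ ≤ ‖w‖ * (17 * (1 - ‖w‖⁻¹ * ⟪ν, w⟫)) := by gcongr
      _ = _ := by field_simp
  -- For the tilt `w = ν + z / 17` one has `‖z‖² = 289 (‖w‖² - 1)`, so `key` reads `‖w‖² - 1 ≤ ‖w‖ -
  -- 1`; since also `‖w‖ ≥ 1`, this gives `‖w‖ = 1` and `z = 0`.
  have hν1 : ‖ν‖ = 1 := mem_sphere_zero_iff_norm.1 hν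
  have hνz : ⟪ν, z⟫ = 0 := by rw [real_inner_comm, hzν]
  set w := ν + (1 / 17 : ℝ) • z with hw
  have hwn : ‖w‖ ^ 2 = 1 + (1 / 17 : ℝ) ^ 2 * ‖z‖ ^ 2 := by
    rw [hw, norm_add_sq_real, hν1, real_inner_smul_right, hνz, norm_smul, mul_pow]
    norm_num
  have hw0 : w ≠ 0 := by
    intro h0
    rw [h0, norm_zero] at hwn
    nlinarith [sq_nonneg ‖z‖]
  have h4 := key w hw0
  rw [hw, inner_add_right, inner_add_right, real_inner_smul_right, real_inner_smul_right, hzν, hνz,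
    real_inner_self_eq_norm_sq, real_inner_self_eq_norm_sq, hν1, ← hw] at h4
  have h5 : ‖z‖ ^ 2 ≤ 0 := by
    nlinarith [sq_nonneg (‖w‖ - 1)]
  have h6 : z = 0 := by
    rw [← norm_eq_zero]
    exact pow_eq_zero_iff two_ne_zero |>.1 (le_antisymm h5 (sq_nonneg _))
  exact sub_eq_zero.1 h6

theorem isClosed_body (e : V) : IsClosed (body e) := by
  have : body e = ⋂ ν ∈ sphere (0 : V) 1, {x | ⟪x, ν⟫ ≤ supportFn e ν} := by
    ext; simp [body]
  rw [this]
  exact isClosed_biInter fun ν _ => isClosed_le (by fun_prop) continuous_const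

theorem inner_lt_of_mem_interior_body {e x ν : V} (hx : x ∈ interior (body e))
    (hν : ν ∈ sphere (0 : V) 1) : ⟪x, ν⟫ < supportFn e ν := by
  obtain ⟨r, hr, h⟩ := Metric.isOpen_iff.1 isOpen_interior x hx
  have hν1 : ‖ν‖ = 1 := mem_sphere_zero_iff_norm.1 hν
  have h1 : x + (r / 2) • ν ∈ body e := by
    refine interior_subset (h ?_)
    rw [mem_ball, dist_eq_norm, add_sub_cancel_left, norm_smul, hν1, mul_one, Real.norm_eq_abs,
      abs_of_pos (by linarith)]
    linarith
  have h2 := h1 ν hν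
  rw [inner_add_left, real_inner_smul_left, real_inner_self_eq_norm_sq, hν1] at h2
  linarith

theorem convex_body (e : V) : Convex ℝ (body e) := by
  intro x hx y hy a b ha hb hab ν hν
  rw [inner_add_left, real_inner_smul_left, real_inner_smul_left]
  calc _ ≤ a * supportFn e ν + b * supportFn e ν := by
        gcongr
        · exact hx ν hν
        · exact hy ν hν
    _ = _ := by rw [← add_mul, hab, one_mul]

theorem boundaryPoint_add_smul_notMem {e ν : V}
    (hν : ν ∈ sphere (0 : V) 1) {ε : ℝ} (hε : 0 < ε) :
    boundaryPoint e ν + ε • ν ∉ body e := by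
  intro h
  have := h ν hν
  rw [inner_add_left, real_inner_smul_left, inner_boundaryPoint_self e hν,
    real_inner_self_eq_norm_sq, mem_sphere_zero_iff_norm.1 hν] at this
  linarith

/-- The body rolls freely in a ball of radius `17`. -/
theorem norm_boundaryPoint_sub_sq_le {e μ ν : V} (he : ‖e‖ = 1)
    (hμ : μ ∈ sphere (0 : V) 1) (hν : ν ∈ sphere (0 : V) 1) :
    ‖boundaryPoint e μ - boundaryPoint e ν‖ ^ 2 ≤
      17 * ⟪boundaryPoint e μ - boundaryPoint e ν, μ - ν⟫ := by
  have key : ∀ α ∈ sphere (0 : V) 1, ∀ β ∈ sphere (0 : V) 1,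
      ‖boundaryPoint e α - (boundaryPoint e β - (17 : ℝ) • β)‖ ≤ 17 := by
    intro α hα β hβ
    set z := boundaryPoint e α - (boundaryPoint e β - (17 : ℝ) • β) with hz
    rcases eq_or_ne z 0 with h0 | h0
    · rw [h0, norm_zero]; norm_num
    have hw' : 0 < ‖z‖ := norm_pos_iff.2 h0
    have hγ : ‖z‖⁻¹ • z ∈ sphere (0 : V) 1 := by
      rw [mem_sphere_zero_iff_norm, norm_smul, norm_inv, norm_norm, inv_mul_cancel₀ hw'.ne']
    have h1 := boundaryPoint_mem_body he hα _ hγ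
    have h2 := support_gap_le he hβ hγ
    have h3 : ⟪z, ‖z‖⁻¹ • z⟫ ≤ 17 := by
      nth_rewrite 1 [hz]
      rw [inner_sub_left, inner_sub_left, real_inner_smul_left]
      linarith
    rw [real_inner_smul_right, real_inner_self_eq_norm_sq] at h3
    calc ‖z‖ = ‖z‖⁻¹ * ‖z‖ ^ 2 := by field_simp
      _ ≤ _ := h3
  -- Squaring the containment in the ball about `boundaryPoint e β - 17 • β`. Adding the two
  -- versions with the roles of the points exchanged gives the claim.
  have sq_key : ∀ α ∈ sphere (0 : V) 1, ∀ β ∈ sphere (0 : V) 1,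
      ‖boundaryPoint e α - boundaryPoint e β‖ ^ 2 +
        34 * ⟪boundaryPoint e α - boundaryPoint e β, β⟫ ≤ 0 := by
    intro α hα β hβ
    have h1 := key α hα β hβ
    have h2 : ‖boundaryPoint e α - (boundaryPoint e β - (17 : ℝ) • β)‖ ^ 2 ≤ 17 ^ 2 := by gcongr
    rw [show boundaryPoint e α - (boundaryPoint e β - (17 : ℝ) • β) =
      (boundaryPoint e α - boundaryPoint e β) + (17 : ℝ) • β by abel, norm_add_sq_real,
      real_inner_smul_right, norm_smul, mem_sphere_zero_iff_norm.1 hβ, Real.norm_eq_abs,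
      abs_of_pos (by norm_num)] at h2
    linarith
  have h1 := sq_key μ hμ ν hν
  have h2 := sq_key ν hν μ hμ
  rw [norm_sub_rev, ← neg_sub (boundaryPoint e μ), inner_neg_left] at h2
  rw [inner_sub_right]
  linarith

/-! ### Compactness, boundary and strict convexity of the body in finite dimension -/

variable [FiniteDimensional ℝ V]

/-- By compactness of the sphere the gap in the support inequality has a positive minimum, and a
ball of that radius around `x` stays in the body. -/
theorem mem_interior_body_of_inner_lt {e x : V}
    (h : ∀ ν ∈ sphere (0 : V) 1, ⟪x, ν⟫ < supportFn e ν) : x ∈ interior (body e) := by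
  rcases (sphere (0 : V) 1).eq_empty_or_nonempty with h0 | h0
  · have : body e = univ := by ext; simp [body, h0]
    simp [this]
  obtain ⟨ν₀, hν₀, hmin⟩ := (isCompact_sphere (0 : V) 1).exists_isMinOn h0
    (f := fun ν => supportFn e ν - ⟪x, ν⟫)
    ((continuous_supportFn e).sub (by fun_prop)).continuousOn
  have hδ : 0 < supportFn e ν₀ - ⟪x, ν₀⟫ := sub_pos.2 (h ν₀ hν₀)
  refine mem_interior_iff_mem_nhds.2 (Filter.mem_of_superset (ball_mem_nhds x hδ) ?_)
  intro y hy ν hν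
  have h1 : supportFn e ν₀ - ⟪x, ν₀⟫ ≤ supportFn e ν - ⟪x, ν⟫ := hmin hν
  have h2 := real_inner_le_norm (y - x) ν
  rw [mem_sphere_zero_iff_norm.1 hν, mul_one, inner_sub_left] at h2
  rw [mem_ball, dist_eq_norm] at hy
  linarith

theorem isCompact_body {e : V} (he : ‖e‖ = 1) : IsCompact (body e) := by
  refine (isCompact_closedBall (0 : V) 10).of_isClosed_subset (isClosed_body e) fun x hx => ?_
  rw [mem_closedBall_zero_iff]
  rcases eq_or_ne x 0 with rfl | h0
  · simp
  have hw' : 0 < ‖x‖ := norm_pos_iff.2 h0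
  have hμ : ‖x‖⁻¹ • x ∈ sphere (0 : V) 1 := by
    rw [mem_sphere_zero_iff_norm, norm_smul, norm_inv, norm_norm, inv_mul_cancel₀ hw'.ne']
  have h1 := (hx _ hμ).trans (supportFn_mem_Icc he hμ).2
  rw [real_inner_smul_right, real_inner_self_eq_norm_sq] at h1
  calc ‖x‖ = ‖x‖⁻¹ * ‖x‖ ^ 2 := by field_simp
    _ ≤ _ := h1

theorem zero_mem_interior_body {e : V} (he : ‖e‖ = 1) : (0 : V) ∈ interior (body e) :=
  mem_interior_body_of_inner_lt fun ν hν => by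
    rw [inner_zero_left]; linarith [(supportFn_mem_Icc he hν).1]

theorem exists_inner_eq_supportFn {e x : V} (hx : x ∈ body e)
    (hx' : x ∉ interior (body e)) :
    ∃ ν ∈ sphere (0 : V) 1, ⟪x, ν⟫ = supportFn e ν := by
  by_contra! h
  exact hx' (mem_interior_body_of_inner_lt fun ν hν => lt_of_le_of_ne (hx ν hν) (h ν hν))

theorem frontier_body {e : V} (he : ‖e‖ = 1) :
    frontier (body e) = boundaryPoint e '' sphere 0 1 := by
  rw [(isClosed_body e).frontier_eq]
  ext x
  constructor
  · rintro ⟨hx, hx'⟩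
    obtain ⟨ν, hν, h⟩ := exists_inner_eq_supportFn hx hx'
    exact ⟨ν, hν, (eq_boundaryPoint_of_inner_eq he hx hν h).symm⟩
  · rintro ⟨ν, hν, rfl⟩
    exact ⟨boundaryPoint_mem_body he hν, fun h =>
      (inner_lt_of_mem_interior_body h hν).ne (inner_boundaryPoint_self e hν)⟩

/-- A proper convex combination outside the interior lies on a supporting hyperplane; then so do
both endpoints, but such a hyperplane meets the body in a single point. -/
theorem strictConvex_body {e : V} (he : ‖e‖ = 1) : StrictConvex ℝ (body e) := by
  intro x hx y hy hxy a b ha hb hab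
  by_contra h
  obtain ⟨ν, hν, h1⟩ := exists_inner_eq_supportFn (convex_body e hx hy ha.le hb.le hab) h
  have hx1 := hx ν hν
  have hy1 := hy ν hν
  rw [inner_add_left, real_inner_smul_left, real_inner_smul_left] at h1
  have h2 : a * (supportFn e ν - ⟪x, ν⟫) + b * (supportFn e ν - ⟪y, ν⟫) = 0 := by
    linear_combination supportFn e ν * hab - h1
  have h3 := mul_nonneg ha.le (sub_nonneg.2 hx1)
  have h4 := mul_nonneg hb.le (sub_nonneg.2 hy1)
  have h5 : ⟪x, ν⟫ = supportFn e ν := by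
    have : a * (supportFn e ν - ⟪x, ν⟫) = 0 := by linarith
    linarith [(mul_eq_zero.1 this).resolve_left ha.ne']
  have h6 : ⟪y, ν⟫ = supportFn e ν := by
    have : b * (supportFn e ν - ⟪y, ν⟫) = 0 := by linarith
    linarith [(mul_eq_zero.1 this).resolve_left hb.ne']
  exact hxy ((eq_boundaryPoint_of_inner_eq he hx hν h5).trans
    (eq_boundaryPoint_of_inner_eq he hy hν h6).symm)

theorem boundaryPoint_sub_smul_mem_interior {e ν : V} (he : ‖e‖ = 1)
    (hν : ν ∈ sphere (0 : V) 1) {ε : ℝ} (hε : ε ∈ Ioo (0 : ℝ) 1) :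
    boundaryPoint e ν - ε • ν ∈ interior (body e) := by
  refine mem_interior_body_of_inner_lt fun μ hμ => ?_
  have h1 := one_sub_inner_le_support_gap he hν hμ
  have h2 := (abs_le.1 (abs_inner_le_one (mem_sphere_zero_iff_norm.1 hν) hμ))
  rw [inner_sub_left, real_inner_smul_left]
  nlinarith [hε.1, hε.2, h2.1, h2.2]

end Body

end SmallMoment

namespace SmallMoment

open Metric
open scoped RealInnerProductSpace

/-! ### The Gauss map and the principal curvatures -/

/-- Along a curve in the boundary, the height in direction `ν` is maximal at the point with outward
normal `ν`, so its derivative vanishes there. -/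
theorem inner_eq_zero_of_isTangentVector {e ν v : E 3}
    (hν : ν ∈ sphere (0 : E 3) 1)
    (hv : IsTangentVector (frontier (body e)) (boundaryPoint e ν) v) : ⟪ν, v⟫ = 0 := by
  obtain ⟨γ, hγ, h0, hd⟩ := hv
  have hd' : HasDerivAt (fun τ => ⟪ν, γ τ⟫) ⟪ν, v⟫ 0 := by
    simpa using (hasDerivAt_const (0 : ℝ) ν).inner ℝ hd
  refine IsLocalMax.hasDerivAt_eq_zero ?_ hd'
  filter_upwards [hγ] with τ hτ
  have h1 := (isClosed_body e).frontier_subset hτ ν hν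
  rw [h0, real_inner_comm, real_inner_comm _ ν, inner_boundaryPoint_self e hν]
  exact h1

theorem isOutwardUnitNormal_gaussMap {e : E 3} (he : ‖e‖ = 1) :
    IsOutwardUnitNormal (body e) (gaussMap e) := by
  refine ⟨by rw [frontier_body he]; exact continuousOn_gaussMap he, ?_⟩
  intro p hp
  have hp' := hp
  rw [frontier_body he] at hp'
  obtain ⟨ν, hν, rfl⟩ := hp'
  rw [gaussMap_boundaryPoint he hν]
  refine ⟨mem_sphere_zero_iff_norm.1 hν, fun v hv => inner_eq_zero_of_isTangentVector hν hv, ?_⟩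
  filter_upwards [Ioo_mem_nhdsGT one_pos] with ε hε
  exact ⟨boundaryPoint_add_smul_notMem hν hε.1, boundaryPoint_sub_smul_mem_interior he hν hε⟩

/-- The left side of `h` is the differential of `boundaryPoint e` at `ν` applied to `v`. So `v` is
an eigenvector of the inverse Gauss map's differential, with the radius of curvature `R` as
eigenvalue. -/
theorem isPrincipal_gaussMap {e ν v : E 3} (he : ‖e‖ = 1) (hν : ν ∈ sphere (0 : E 3) 1)
    (hv : ‖v‖ = 1) (hνv : ⟪ν, v⟫ = 0) {R : ℝ} (hR : R ≠ 0)
    (h : (9 - 8 * ⟪e, ν⟫ ^ 3) • v + (24 * ⟪e, ν⟫ * ⟪e, v⟫) • (e - ⟪e, ν⟫ • ν) = R • v) :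
    IsPrincipal (boundaryPoint e '' sphere 0 1) (gaussMap e) (boundaryPoint e ν) R⁻¹ v := by
  set κ := R⁻¹ with hκ
  -- A great circle of normals, run at speed `κ = 1 / R` so that the corresponding boundary curve
  -- has velocity exactly `v`.
  set n : ℝ → E 3 := fun τ => Real.cos (κ * τ) • ν + Real.sin (κ * τ) • v with hn
  have hns : ∀ τ, n τ ∈ sphere (0 : E 3) 1 := by
    intro τ
    rw [mem_sphere_zero_iff_norm, ← sq_eq_sq₀ (norm_nonneg _) zero_le_one, hn,
      norm_add_sq_real, norm_smul, norm_smul, hv, mem_sphere_zero_iff_norm.1 hν,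
      real_inner_smul_left, real_inner_smul_right, hνv, Real.norm_eq_abs, Real.norm_eq_abs, mul_one,
      mul_one, sq_abs, sq_abs]
    linarith [Real.sin_sq_add_cos_sq (κ * τ)]
  have hn0 : n 0 = ν := by simp [hn]
  have hmul : HasDerivAt (fun τ : ℝ => κ * τ) κ 0 := by
    simpa using (hasDerivAt_id (0 : ℝ)).const_mul κ
  have hdn : HasDerivAt n (κ • v) 0 := by
    have := (hmul.cos.smul_const ν).add (hmul.sin.smul_const v)
    exact HasDerivAt.congr_deriv (f := n) this (by simp)
  have hdc : HasDerivAt (fun τ => ⟪e, n τ⟫) (κ * ⟪e, v⟫) 0 := by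
    have := (hasDerivAt_const (0 : ℝ) e).inner ℝ hdn
    simpa [real_inner_smul_right] using this
  refine ⟨fun h0 => by simp [h0] at hv, fun τ => boundaryPoint e (n τ),
    Eventually.of_forall fun τ => ⟨n τ, hns τ, rfl⟩, by simp only [hn0], ?_, ?_⟩
  · have h1 := (((hdc.pow 3).const_mul 8).const_sub 9).smul hdn
    have h2 := (((hdc.pow 2).const_mul 12).sub_const 3).smul_const e
    have h3 := h1.add h2
    refine HasDerivAt.congr_deriv (f := fun τ => boundaryPoint e (n τ)) h3 ?_
    have hκR : κ * R = 1 := inv_mul_cancel₀ hR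
    have h4 : v = κ • ((9 - 8 * ⟪e, ν⟫ ^ 3) • v + (24 * ⟪e, ν⟫ * ⟪e, v⟫) • (e - ⟪e, ν⟫ • ν)) := by
      rw [h, smul_smul, hκR, one_smul]
    rw [hn0]
    conv_rhs => rw [h4]
    simp only [Pi.pow_apply, hn0]
    push_cast
    module
  · simp only [gaussMap_boundaryPoint he (hns _)]
    exact hdn

/-- The two rolling-ball inequalities, divided by `τ²`, pass to the limit along the curve and become
`κ² ‖v‖² ≤ κ ‖v‖²` and `‖v‖² ≤ 17 κ ‖v‖²`. -/
theorem isPrincipal_gaussMap_bounds {e p v : E 3} (he : ‖e‖ = 1) {κ : ℝ}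
    (hp : p ∈ boundaryPoint e '' sphere 0 1)
    (h : IsPrincipal (boundaryPoint e '' sphere 0 1) (gaussMap e) p κ v) :
    1 / 17 ≤ κ ∧ κ ≤ 1 := by
  obtain ⟨ν, hν, rfl⟩ := hp
  obtain ⟨hv, γ, hγ, h0, hd, hdN⟩ := h
  rw [hasDerivAt_iff_tendsto_slope] at hd hdN
  have hγ' : ∀ᶠ τ in 𝓝[≠] (0 : ℝ), γ τ ∈ boundaryPoint e '' sphere 0 1 :=
    hγ.filter_mono nhdsWithin_le_nhds
  have key : ∀ᶠ τ in 𝓝[≠] (0 : ℝ),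
      ‖slope (fun τ => gaussMap e (γ τ)) 0 τ‖ ^ 2 ≤
        ⟪slope γ 0 τ, slope (fun τ => gaussMap e (γ τ)) 0 τ⟫ ∧
      ‖slope γ 0 τ‖ ^ 2 ≤ 17 * ⟪slope γ 0 τ, slope (fun τ => gaussMap e (γ τ)) 0 τ⟫ := by
    filter_upwards [hγ'] with τ hτ
    obtain ⟨μ, hμ, hμτ⟩ := hτ
    simp only [slope_def_module, h0, ← hμτ, gaussMap_boundaryPoint he hμ,
      gaussMap_boundaryPoint he hν, norm_smul, mul_pow, real_inner_smul_left,
      real_inner_smul_right, Real.norm_eq_abs, sq_abs]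
    have h1 := mul_le_mul_of_nonneg_left (norm_sub_sq_le_inner he hμ hν) (sq_nonneg (τ - 0)⁻¹)
    have h2 := mul_le_mul_of_nonneg_left (norm_boundaryPoint_sub_sq_le he hμ hν)
      (sq_nonneg (τ - 0)⁻¹)
    constructor <;> linarith
  have h1 := le_of_tendsto_of_tendsto (hdN.norm.pow 2) (hd.inner hdN) (key.mono fun _ h => h.1)
  have h2 := le_of_tendsto_of_tendsto (hd.norm.pow 2) ((hd.inner hdN).const_mul 17)
    (key.mono fun _ h => h.2)
  rw [norm_smul, mul_pow, Real.norm_eq_abs, sq_abs, real_inner_smul_right,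
    real_inner_self_eq_norm_sq] at h1
  rw [real_inner_smul_right, real_inner_self_eq_norm_sq] at h2
  have hv' : 0 < ‖v‖ ^ 2 := by positivity
  have h3 : κ ^ 2 ≤ κ := le_of_mul_le_mul_right h1 hv'
  have h4 : 1 ≤ 17 * κ := le_of_mul_le_mul_right (by linarith) hv'
  constructor
  · linarith
  · nlinarith

/-! ### The body is bounded by a star-shaped, connected surface -/

/-- The radial function is the reciprocal of the Minkowski gauge, which is continuous, positive off
the origin, and equal to 1 exactly on the boundary. -/
theorem isStarShaped_frontier {K : Set (E 3)} (hK : IsCompact K) (hc : Convex ℝ K)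
    (h0 : (0 : E 3) ∈ interior K) : IsStarShaped (frontier K) := by
  have hn : K ∈ 𝓝 (0 : E 3) := mem_interior_iff_mem_nhds.1 h0
  have hpos : ∀ θ : E 3, θ ≠ 0 → 0 < gauge K θ := fun θ hθ =>
    (gauge_pos (absorbent_nhds_zero hn)
      ((NormedSpace.isVonNBounded_iff ℝ).2 hK.isBounded)).2 hθ
  have hne : ∀ θ ∈ sphere (0 : E 3) 1, θ ≠ 0 := by
    rintro θ hθ rfl
    simp at hθ
  refine ⟨0, fun θ => (gauge K θ)⁻¹, ?_, fun θ hθ => inv_pos.2 (hpos θ (hne θ hθ)), ?_⟩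
  · exact (continuous_gauge hc hn).continuousOn.inv₀ fun θ hθ => (hpos θ (hne θ hθ)).ne'
  · ext x
    rw [← gauge_eq_one_iff_mem_frontier hc hn]
    constructor
    · intro hx
      have hx0 : x ≠ 0 := by rintro rfl; simp at hx
      have hxn : ‖x‖ ≠ 0 := norm_ne_zero_iff.2 hx0
      refine ⟨‖x‖⁻¹ • x, ?_, ?_⟩
      · rw [mem_sphere_zero_iff_norm, norm_smul, norm_inv, norm_norm, inv_mul_cancel₀ hxn]
      · simp only
        rw [gauge_smul_of_nonneg (by positivity), hx, smul_smul, zero_add]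
        simp [hxn]
    · rintro ⟨θ, hθ, rfl⟩
      have h1 := hpos θ (hne θ hθ)
      simp only [zero_add]
      rw [gauge_smul_of_nonneg (by positivity), smul_eq_mul, inv_mul_cancel₀ h1.ne']

theorem isConnected_boundaryPoint_image (e : E 3) :
    IsConnected (boundaryPoint e '' sphere (0 : E 3) 1) :=
  (isConnected_sphere (by rw [← Module.finrank_eq_rank]; simp) 0 zero_le_one).image _ (continuous_boundaryPoint e).continuousOn

end SmallMoment

namespace SmallMoment

open Metric
open scoped RealInnerProductSpace

/-! ### The curve and the surface as boundaries -/

/-- The axis of rotation in the plane of the curve. -/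
noncomputable def axis₂ : E 2 := EuclideanSpace.single 1 1

/-- The axis of rotation in space. -/
noncomputable def axis₃ : E 3 := EuclideanSpace.single 2 1

theorem norm_axis₂ : ‖axis₂‖ = 1 := by simp [axis₂]

theorem norm_axis₃ : ‖axis₃‖ = 1 := by simp [axis₃]

theorem inner_axis₂ (x : E 2) : ⟪axis₂, x⟫ = x 1 := by
  simp [axis₂, EuclideanSpace.inner_single_left]

theorem inner_axis₃ (x : E 3) : ⟪axis₃, x⟫ = x 2 := by
  simp [axis₃, EuclideanSpace.inner_single_left]

/-- The point of the unit sphere with polar angle `t` and azimuth `s`. -/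
noncomputable def spherePoint (t s : ℝ) : E 3 :=
  !₂[Real.sin t * Real.cos s, Real.sin t * Real.sin s, Real.cos t]

theorem spherePoint_mem (t s : ℝ) : spherePoint t s ∈ sphere (0 : E 3) 1 := by
  rw [mem_sphere_zero_iff_norm, ← sq_eq_sq₀ (norm_nonneg _) zero_le_one,
    EuclideanSpace.real_norm_sq_eq, Fin.sum_univ_three]
  simp only [spherePoint]
  simp
  linear_combination Real.sin t ^ 2 * Real.sin_sq_add_cos_sq s + Real.sin_sq_add_cos_sq t

theorem exists_polar (x y : ℝ) :
    ∃ s ∈ Icc 0 (2 * Real.pi), x = √(x ^ 2 + y ^ 2) * Real.cos s ∧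
      y = √(x ^ 2 + y ^ 2) * Real.sin s := by
  set z : ℂ := ⟨x, y⟩ with hz
  have hn : ‖z‖ = √(x ^ 2 + y ^ 2) := by
    rw [Complex.norm_eq_sqrt_sq_add_sq]
  have h1 := Complex.norm_mul_cos_arg z
  have h2 := Complex.norm_mul_sin_arg z
  rw [hn] at h1 h2
  rcases le_or_gt 0 z.arg with h | h
  · exact ⟨z.arg, ⟨h, by linarith [Complex.arg_le_pi z, Real.pi_pos]⟩, h1.symm, h2.symm⟩
  · refine ⟨z.arg + 2 * Real.pi, ⟨by linarith [Complex.neg_pi_lt_arg z, Real.pi_pos],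
      by linarith⟩, ?_, ?_⟩
    · rw [Real.cos_add_two_pi]; exact h1.symm
    · rw [Real.sin_add_two_pi]; exact h2.symm

theorem exists_spherePoint_eq {ν : E 3} (hν : ν ∈ sphere (0 : E 3) 1) :
    ∃ t ∈ Icc 0 Real.pi, ∃ s ∈ Icc 0 (2 * Real.pi), ν = spherePoint t s := by
  have h1 : ν 0 ^ 2 + ν 1 ^ 2 + ν 2 ^ 2 = 1 := by
    have := EuclideanSpace.real_norm_sq_eq ν
    rw [mem_sphere_zero_iff_norm.1 hν, Fin.sum_univ_three] at this
    linarith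
  have h2 : ν 2 ∈ Icc (-1 : ℝ) 1 := by
    constructor <;> nlinarith [sq_nonneg (ν 0), sq_nonneg (ν 1)]
  obtain ⟨s, hs, h3, h4⟩ := exists_polar (ν 0) (ν 1)
  refine ⟨Real.arccos (ν 2), ⟨Real.arccos_nonneg _, Real.arccos_le_pi _⟩, s, hs, ?_⟩
  have h5 : Real.sin (Real.arccos (ν 2)) = √(ν 0 ^ 2 + ν 1 ^ 2) := by
    rw [Real.sin_arccos]; congr 1; linarith
  ext i
  fin_cases i
  · simpa [spherePoint, h5] using h3
  · simpa [spherePoint, h5] using h4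
  · simp [spherePoint, Real.cos_arccos h2.1 h2.2]

theorem curveX_eq (t : ℝ) : curveX t = (9 - 8 * Real.cos t ^ 3) * Real.sin t := by
  rw [curveX, Real.cos_three_mul, Real.sin_three_mul]
  linear_combination 12 * Real.sin t * Real.cos t * Real.sin_sq_add_cos_sq t

theorem curveY_eq (t : ℝ) :
    curveY t = -8 * Real.cos t ^ 4 + 12 * Real.cos t ^ 2 + 9 * Real.cos t - 3 := by
  rw [curveY, Real.cos_three_mul, Real.sin_three_mul]
  linear_combination (9 - 12 * (Real.sin t ^ 2 - Real.cos t ^ 2) - 12) *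
    Real.sin_sq_add_cos_sq t

theorem param_eq (t s : ℝ) : param t s = boundaryPoint axis₃ (spherePoint t s) := by
  ext i
  simp only [boundaryPoint, inner_axis₃, param, curveX_eq, curveY_eq]
  fin_cases i
  · simp [spherePoint, axis₃]; ring
  · simp [spherePoint, axis₃]; ring
  · simp [spherePoint, axis₃]; ring

theorem curve_eq : curve = boundaryPoint axis₂ '' sphere 0 1 := by
  have key : ∀ t : ℝ, (!₂[curveX t, curveY t] : E 2) =
      boundaryPoint axis₂ !₂[Real.sin t, Real.cos t] := by
    intro t
    ext i
    simp only [boundaryPoint, inner_axis₂, curveX_eq, curveY_eq]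
    fin_cases i
    · simp [axis₂]
    · simp [axis₂]; ring
  ext x
  constructor
  · rintro ⟨t, -, rfl⟩
    refine ⟨!₂[Real.sin t, Real.cos t], ?_, (key t).symm⟩
    rw [mem_sphere_zero_iff_norm, ← sq_eq_sq₀ (norm_nonneg _) zero_le_one,
      EuclideanSpace.real_norm_sq_eq]
    simp
  · rintro ⟨ν, hν, rfl⟩
    have h1 := EuclideanSpace.real_norm_sq_eq ν
    rw [mem_sphere_zero_iff_norm.1 hν, Fin.sum_univ_two, one_pow] at h1
    -- The coordinates are swapped because the parameter of the curve is the angle from the second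
    -- axis.
    obtain ⟨s, hs, h2, h3⟩ := exists_polar (ν 1) (ν 0)
    rw [add_comm, ← h1, Real.sqrt_one, one_mul] at h2 h3
    refine ⟨s, hs, ?_⟩
    simp only [key]
    congr 1
    ext i
    fin_cases i
    · simp [h3]
    · simp [h2]

theorem surface_eq : surface = boundaryPoint axis₃ '' sphere 0 1 := by
  ext p
  constructor
  · rintro ⟨_, ⟨t, -, rfl⟩, s, rfl⟩
    exact ⟨spherePoint t s, spherePoint_mem t s, by rw [← param_eq]; simp [param]⟩
  · rintro ⟨ν, hν, rfl⟩
    obtain ⟨t, ht, s, -, rfl⟩ := exists_spherePoint_eq hν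
    refine ⟨_, ⟨t, ⟨ht.1, ht.2.trans (by linarith [Real.pi_pos])⟩, rfl⟩, s, ?_⟩
    rw [← param_eq]
    simp [param]

theorem surface_eq_param :
    surface = {p | ∃ t ∈ Icc 0 Real.pi, ∃ s ∈ Icc 0 (2 * Real.pi), p = param t s} := by
  rw [surface_eq]
  ext p
  constructor
  · rintro ⟨ν, hν, rfl⟩
    obtain ⟨t, ht, s, hs, rfl⟩ := exists_spherePoint_eq hν
    exact ⟨t, ht, s, hs, (param_eq t s).symm⟩
  · rintro ⟨t, -, s, -, rfl⟩
    exact ⟨spherePoint t s, spherePoint_mem t s, (param_eq t s).symm⟩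

theorem isConstantWidthCurve_curve : IsConstantWidthCurve curve 18 := by
  have he := norm_axis₂
  refine ⟨body axis₂, isCompact_body he, convex_body _, ⟨0, zero_mem_interior_body he⟩,
    (frontier_body he).trans curve_eq.symm, fun u hu => ?_⟩
  have hu' : u ∈ sphere (0 : E 2) 1 := mem_sphere_zero_iff_norm.2 hu
  have hn' : -u ∈ sphere (0 : E 2) 1 := by simpa using hu'
  refine ⟨supportFn axis₂ u, -supportFn axis₂ (-u), ⟨?_, ?_⟩, ⟨?_, ?_⟩, ?_⟩
  · refine ⟨_, boundaryPoint_mem_body he hu', ?_⟩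
    simp only
    rw [real_inner_comm, inner_boundaryPoint_self _ hu']
  · rintro _ ⟨x, hx, rfl⟩
    simp only
    rw [real_inner_comm]
    exact hx u hu'
  · refine ⟨_, boundaryPoint_mem_body he hn', ?_⟩
    simp only
    rw [← inner_boundaryPoint_self _ hn', inner_neg_right, neg_neg, real_inner_comm]
  · rintro _ ⟨x, hx, rfl⟩
    have := hx (-u) hn'
    rw [inner_neg_right, real_inner_comm] at this
    simp only
    linarith
  · linarith [supportFn_add_supportFn_neg axis₂ u]

/-! ### Principal directions along meridians and parallels -/

theorem curvature_radius_pos (t : ℝ) :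
    0 < 9 - 8 * Real.cos (3 * t) ∧ 0 < 9 - 8 * Real.cos t ^ 3 := by
  have h1 := Real.cos_le_one (3 * t)
  have h2 : Real.cos t ^ 3 ≤ 1 := by
    nlinarith [Real.cos_le_one t, Real.neg_one_le_cos t, sq_nonneg (Real.cos t)]
  constructor <;> linarith

theorem kappa₁_eq (t : ℝ) : kappa₁ t = (9 - 8 * Real.cos (3 * t))⁻¹ := by
  rw [kappa₁, Real.sqrt_sq (curvature_radius_pos t).1.le, one_div]

theorem kappa₂_eq (t : ℝ) : kappa₂ t = (9 - 8 * Real.cos t ^ 3)⁻¹ := by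
  obtain ⟨h1, h2⟩ := curvature_radius_pos t
  rw [kappa₂, Real.sqrt_sq h1.le]
  have h3 : 8 * Real.cos t ^ 3 - 9 ≠ 0 := by linarith
  field_simp
  ring

theorem exists_principal_directions (t s : ℝ) :
    ∃ e₁ e₂ : E 3, ‖e₁‖ = 1 ∧ ‖e₂‖ = 1 ∧ inner ℝ e₁ e₂ = 0 ∧
      IsPrincipal surface (gaussMap axis₃) (param t s) (kappa₁ t) e₁ ∧
      IsPrincipal surface (gaussMap axis₃) (param t s) (kappa₂ t) e₂ := by
  have he := norm_axis₃
  have hts := Real.sin_sq_add_cos_sq t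
  have hss := Real.sin_sq_add_cos_sq s
  have h1 : ‖(!₂[Real.cos t * Real.cos s, Real.cos t * Real.sin s, -Real.sin t] : E 3)‖ = 1 := by
    rw [← sq_eq_sq₀ (norm_nonneg _) zero_le_one, EuclideanSpace.real_norm_sq_eq,
      Fin.sum_univ_three]
    simp
    linear_combination Real.cos t ^ 2 * hss + hts
  have h2 : ‖(!₂[-Real.sin s, Real.cos s, 0] : E 3)‖ = 1 := by
    rw [← sq_eq_sq₀ (norm_nonneg _) zero_le_one, EuclideanSpace.real_norm_sq_eq,
      Fin.sum_univ_three]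
    simp
  refine ⟨_, _, h1, h2, ?_, ?_, ?_⟩
  · simp [PiLp.inner_apply, Fin.sum_univ_three]
    ring
  · rw [surface_eq, param_eq, kappa₁_eq]
    refine isPrincipal_gaussMap he (spherePoint_mem t s) h1 ?_ (curvature_radius_pos t).1.ne' ?_
    · simp [spherePoint, PiLp.inner_apply, Fin.sum_univ_three]
      linear_combination Real.sin t * Real.cos t * hss
    · rw [inner_axis₃, inner_axis₃, Real.cos_three_mul]
      ext i
      fin_cases i
      · simp [spherePoint, axis₃]
        linear_combination 24 * Real.cos t ^ 2 * Real.cos s * hts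
      · simp [spherePoint, axis₃]
        linear_combination 24 * Real.cos t ^ 2 * Real.sin s * hts
      · simp [spherePoint, axis₃]
        ring
  · rw [surface_eq, param_eq, kappa₂_eq]
    refine isPrincipal_gaussMap he (spherePoint_mem t s) h2 ?_ (curvature_radius_pos t).2.ne' ?_
    · simp [spherePoint, PiLp.inner_apply, Fin.sum_univ_three]
      ring
    · rw [inner_axis₃, inner_axis₃]
      ext i
      fin_cases i <;> simp [spherePoint]

end SmallMoment

namespace SmallMoment

open Metric
open scoped RealInnerProductSpace ContDiff

/-! ### Analytic charts -/

/-- The conformal factor of stereographic projection. -/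
noncomputable def stereoFactor (u : E 2) : ℝ := 1 + (u 0 ^ 2 + u 1 ^ 2)

/-- The inverse of the stereographic projection of the unit sphere from the pole `-σ e₃`,
where `σ = ± 1`. -/
noncomputable def stereoInv (σ : ℝ) (u : E 2) : E 3 :=
  !₂[2 * u 0 / stereoFactor u, 2 * u 1 / stereoFactor u, σ * (2 - stereoFactor u) / stereoFactor u]

/-- The stereographic projection from the pole `-σ e₃`. -/
noncomputable def stereoProj (σ : ℝ) (ν : E 3) : E 2 :=
  !₂[ν 0 / (1 + σ * ν 2), ν 1 / (1 + σ * ν 2)]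

theorem stereoFactor_pos (u : E 2) : 0 < stereoFactor u := by
  unfold stereoFactor; positivity

theorem stereoInv_mem_sphere {σ : ℝ} (hσ : σ ^ 2 = 1) (u : E 2) :
    stereoInv σ u ∈ sphere (0 : E 3) 1 := by
  have h := (stereoFactor_pos u).ne'
  rw [mem_sphere_zero_iff_norm, ← sq_eq_sq₀ (norm_nonneg _) zero_le_one,
    EuclideanSpace.real_norm_sq_eq, Fin.sum_univ_three]
  simp [stereoInv]
  field_simp
  rw [hσ, stereoFactor]
  ring

theorem one_add_mul_stereoInv {σ : ℝ} (hσ : σ ^ 2 = 1) (u : E 2) :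
    1 + σ * stereoInv σ u 2 = 2 / stereoFactor u := by
  have h := (stereoFactor_pos u).ne'
  simp [stereoInv]
  field_simp
  rw [hσ]
  ring

theorem stereoProj_stereoInv {σ : ℝ} (hσ : σ ^ 2 = 1) (u : E 2) :
    stereoProj σ (stereoInv σ u) = u := by
  have h := (stereoFactor_pos u).ne'
  rw [stereoProj, one_add_mul_stereoInv hσ]
  ext i
  fin_cases i <;> simp [stereoInv] <;> field_simp

theorem stereoInv_stereoProj {σ : ℝ} (hσ : σ ^ 2 = 1) {ν : E 3} (hν : ν ∈ sphere (0 : E 3) 1)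
    (h : 1 + σ * ν 2 ≠ 0) : stereoInv σ (stereoProj σ ν) = ν := by
  have h1 := EuclideanSpace.real_norm_sq_eq ν
  rw [mem_sphere_zero_iff_norm.1 hν, Fin.sum_univ_three] at h1
  have h2 : stereoFactor (stereoProj σ ν) = 2 / (1 + σ * ν 2) := by
    simp [stereoFactor, stereoProj]
    field_simp
    linear_combination -h1 + ν 2 ^ 2 * hσ
  rw [stereoInv, h2]
  ext i
  fin_cases i
  · simp [stereoProj]; field_simp
  · simp [stereoProj]; field_simp
  · simp; field_simp; linear_combination ν 2 * hσ

/-- The chordal distance formula; it supplies the lower bound that makes the charts immersive. -/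
theorem norm_stereoInv_sub_sq {σ : ℝ} (hσ : σ ^ 2 = 1) (u v : E 2) :
    ‖stereoInv σ u - stereoInv σ v‖ ^ 2 =
      4 * ‖u - v‖ ^ 2 / (stereoFactor u * stereoFactor v) := by
  have hu := (stereoFactor_pos u).ne'
  have hv := (stereoFactor_pos v).ne'
  rw [EuclideanSpace.real_norm_sq_eq, EuclideanSpace.real_norm_sq_eq, Fin.sum_univ_three,
    Fin.sum_univ_two]
  simp only [stereoInv]
  simp
  have h3 : (σ * (2 - stereoFactor u) / stereoFactor u -
      σ * (2 - stereoFactor v) / stereoFactor v) ^ 2 =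
      ((2 - stereoFactor u) / stereoFactor u - (2 - stereoFactor v) / stereoFactor v) ^ 2 := by
    rw [mul_div_assoc, mul_div_assoc, ← mul_sub, mul_pow, hσ, one_mul]
  rw [h3]
  field_simp
  unfold stereoFactor
  ring

theorem contDiff_boundaryPoint_stereoInv (e : E 3) (σ : ℝ) :
    ContDiff ℝ ω fun u => boundaryPoint e (stereoInv σ u) := by
  have h0 : ContDiff ℝ ω stereoFactor := by
    unfold stereoFactor
    fun_prop
  have h1 : ContDiff ℝ ω (stereoInv σ) := by
    rw [contDiff_euclidean]
    intro i
    fin_cases i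
    · exact ContDiff.div (by fun_prop) h0 fun u => (stereoFactor_pos u).ne'
    · exact ContDiff.div (by fun_prop) h0 fun u => (stereoFactor_pos u).ne'
    · exact ContDiff.div (by fun_prop) h0 fun u => (stereoFactor_pos u).ne'
  have h2 : ContDiff ℝ ω fun u => ⟪e, stereoInv σ u⟫ := contDiff_const.inner ℝ h1
  unfold boundaryPoint
  fun_prop

/-- `boundaryPoint e` does not decrease distances on the sphere, so difference quotients of the
chart dominate those of `stereoInv`. In the limit the derivative along `w` has norm at least `2 ‖w‖
/ stereoFactor u`. -/
theorem injective_fderiv_boundaryPoint_stereoInv {e : E 3} (he : ‖e‖ = 1) {σ : ℝ}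
    (hσ : σ ^ 2 = 1) (u : E 2) :
    Function.Injective (fderiv ℝ (fun u => boundaryPoint e (stereoInv σ u)) u) := by
  set F := fun u => boundaryPoint e (stereoInv σ u) with hF
  have hd : HasFDerivAt F (fderiv ℝ F u) u :=
    ((contDiff_boundaryPoint_stereoInv e σ).differentiable (by simp) u).hasFDerivAt
  rw [injective_iff_map_eq_zero]
  intro w hw
  have hline : HasDerivAt (fun τ : ℝ => u + τ • w) w 0 := by
    simpa using ((hasDerivAt_id (0 : ℝ)).smul_const w).const_add u
  have hd' : HasDerivAt (fun τ : ℝ => F (u + τ • w)) (fderiv ℝ F u w) 0 := by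
    have hd0 : HasFDerivAt F (fderiv ℝ F u) (u + (0 : ℝ) • w) := by
      rwa [zero_smul, add_zero]
    exact hd0.comp_hasDerivAt (0 : ℝ) hline
  rw [hasDerivAt_iff_tendsto_slope, hw] at hd'
  have hcont : Continuous fun τ : ℝ =>
      4 * ‖w‖ ^ 2 / (stereoFactor (u + τ • w) * stereoFactor u) := by
    refine continuous_const.div ?_ fun τ => (mul_pos (stereoFactor_pos _) (stereoFactor_pos _)).ne'
    unfold stereoFactor
    fun_prop
  have hlim := (hcont.tendsto 0).mono_left (nhdsWithin_le_nhds (s := {0}ᶜ))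
  have hle : ∀ᶠ τ in 𝓝[≠] (0 : ℝ), 4 * ‖w‖ ^ 2 / (stereoFactor (u + τ • w) * stereoFactor u) ≤
      ‖slope (fun τ : ℝ => F (u + τ • w)) 0 τ‖ ^ 2 := by
    filter_upwards [self_mem_nhdsWithin] with τ hτ
    have hτ : τ ≠ 0 := hτ
    have h1 := norm_sub_le_norm_boundaryPoint_sub he (stereoInv_mem_sphere hσ (u + τ • w))
      (stereoInv_mem_sphere hσ u)
    have h2 : ‖stereoInv σ (u + τ • w) - stereoInv σ u‖ ^ 2 ≤ ‖F (u + τ • w) - F u‖ ^ 2 := by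
      gcongr
    rw [norm_stereoInv_sub_sq hσ, add_sub_cancel_left, norm_smul, mul_pow, Real.norm_eq_abs,
      sq_abs] at h2
    rw [slope_def_module, norm_smul, mul_pow, zero_smul, add_zero, sub_zero, norm_inv,
      Real.norm_eq_abs, inv_pow, sq_abs]
    calc _ = (τ ^ 2)⁻¹ * (4 * (τ ^ 2 * ‖w‖ ^ 2) / (stereoFactor (u + τ • w) * stereoFactor u)) := by
          field_simp
      _ ≤ _ := by gcongr
  have h := le_of_tendsto_of_tendsto hlim (hd'.norm.pow 2) hle
  rw [zero_smul, add_zero, norm_zero, zero_pow two_ne_zero] at h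
  have hq := stereoFactor_pos u
  have h1 : 4 * ‖w‖ ^ 2 ≤ 0 := by
    by_contra! h2
    exact absurd h (not_le.2 (by positivity))
  have h2 : ‖w‖ ^ 2 = 0 := le_antisymm (by linarith) (sq_nonneg _)
  exact norm_eq_zero.1 (pow_eq_zero_iff two_ne_zero |>.1 h2)

/-- Two stereographic charts suffice, each missing only the image of its pole `P`. The inverse chart
is continuous because the Gauss map is Lipschitz. -/
theorem isAnalyticSurface_boundaryPoint_image {e : E 3} (he : ‖e‖ = 1) :
    IsAnalyticSurface (boundaryPoint e '' sphere (0 : E 3) 1) := by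
  rintro _ ⟨ν, hν, rfl⟩
  obtain ⟨σ, hσ, hνσ⟩ : ∃ σ : ℝ, σ ^ 2 = 1 ∧ 1 + σ * ν 2 ≠ 0 := by
    by_cases h : 1 + 1 * ν 2 = 0
    · exact ⟨-1, by norm_num, by linarith⟩
    · exact ⟨1, by norm_num, h⟩
  set P : E 3 := !₂[0, 0, -σ] with hP
  have hPs : P ∈ sphere (0 : E 3) 1 := by
    rw [mem_sphere_zero_iff_norm, ← sq_eq_sq₀ (norm_nonneg _) zero_le_one,
      EuclideanSpace.real_norm_sq_eq, Fin.sum_univ_three]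
    simpa [hP] using hσ
  have hP2 : 1 + σ * P 2 = 0 := by
    simp [hP]
    linear_combination -hσ
  have hPne : ∀ μ ∈ sphere (0 : E 3) 1, boundaryPoint e μ ≠ boundaryPoint e P →
      1 + σ * μ 2 ≠ 0 := by
    intro μ hμ hne h0
    refine hne (congrArg _ ?_)
    have h1 := EuclideanSpace.real_norm_sq_eq μ
    rw [mem_sphere_zero_iff_norm.1 hμ, Fin.sum_univ_three] at h1
    have h2 : μ 2 = -σ := by linear_combination σ * h0 - μ 2 * hσ
    rw [h2] at h1
    have h3 : μ 0 = 0 := by nlinarith [sq_nonneg (μ 0), sq_nonneg (μ 1)]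
    have h4 : μ 1 = 0 := by nlinarith [sq_nonneg (μ 0), sq_nonneg (μ 1)]
    ext i
    fin_cases i
    · simpa [hP] using h3
    · simpa [hP] using h4
    · simpa [hP] using h2
  have hneP : ∀ μ ∈ sphere (0 : E 3) 1, 1 + σ * μ 2 ≠ 0 →
      boundaryPoint e μ ≠ boundaryPoint e P := by
    intro μ hμ h0 heq
    rw [injOn_boundaryPoint he hμ hPs heq] at h0
    exact h0 hP2
  refine ⟨univ, {boundaryPoint e P}ᶜ, fun u => boundaryPoint e (stereoInv σ u),
    stereoProj σ ∘ gaussMap e, isOpen_univ, isOpen_compl_singleton, hneP ν hν hνσ,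
    contDiff_omega_iff_analyticOnNhd.1 (contDiff_boundaryPoint_stereoInv e σ),
    fun u _ => injective_fderiv_boundaryPoint_stereoInv he hσ u, ?_, ?_, ?_⟩
  · ext x
    constructor
    · rintro ⟨u, -, rfl⟩
      have h1 := stereoInv_mem_sphere hσ u
      refine ⟨⟨_, h1, rfl⟩, hneP _ h1 ?_⟩
      rw [one_add_mul_stereoInv hσ]
      exact (div_pos two_pos (stereoFactor_pos u)).ne'
    · rintro ⟨⟨μ, hμ, rfl⟩, hne⟩
      exact ⟨stereoProj σ μ, mem_univ _, by
        simp only [stereoInv_stereoProj hσ hμ (hPne μ hμ hne)]⟩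
  · have h1 : ContinuousOn (stereoProj σ) {μ | 1 + σ * μ 2 ≠ 0} := by
      refine (PiLp.continuous_toLp 2 _).comp_continuousOn (continuousOn_pi.2 fun i => ?_)
      fin_cases i
      · exact ContinuousOn.div (by fun_prop) (by fun_prop) fun μ hμ => hμ
      · exact ContinuousOn.div (by fun_prop) (by fun_prop) fun μ hμ => hμ
    refine h1.comp ((continuousOn_gaussMap he).mono inter_subset_left) ?_
    rintro _ ⟨⟨μ, hμ, rfl⟩, hne⟩
    rw [gaussMap_boundaryPoint he hμ]
    exact hPne μ hμ hne
  · intro u _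
    simp only [Function.comp_apply]
    rw [gaussMap_boundaryPoint he (stereoInv_mem_sphere hσ u), stereoProj_stereoInv hσ]

end SmallMoment

namespace SmallMoment

open Metric Module
open scoped RealInnerProductSpace NNReal ENNReal

/-! ### Integration over surfaces of revolution -/

/-- The parametrization of the surface of revolution of the plane curve `(f, g)`. -/
noncomputable def revolution (f g : ℝ → ℝ) (u : E 2) : E 3 :=
  !₂[f (u 0) * Real.cos (u 1), f (u 0) * Real.sin (u 1), g (u 0)]

/-- The coordinates of the plane. -/
def planeCoord (u : E 2) : ℝ × ℝ := (u 0, u 1)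

theorem measurePreserving_planeCoord : MeasurePreserving planeCoord volume volume :=
  (volume_preserving_finTwoArrow ℝ).comp
    (EuclideanSpace.volume_preserving_symm_measurableEquiv_toLp (Fin 2))

theorem measurableEmbedding_planeCoord : MeasurableEmbedding planeCoord :=
  ((MeasurableEquiv.toLp 2 (Fin 2 → ℝ)).symm.trans
    MeasurableEquiv.finTwoArrow).measurableEmbedding

/-- The open parameter domain of a surface of revolution. -/
def openBox : Set (E 2) := planeCoord ⁻¹' (Ioo 0 Real.pi ×ˢ Ioo 0 (2 * Real.pi))

/-- The closed parameter domain of a surface of revolution. -/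
def closedBox : Set (E 2) := planeCoord ⁻¹' (Icc 0 Real.pi ×ˢ Icc 0 (2 * Real.pi))

theorem continuous_planeCoord : Continuous planeCoord := by
  unfold planeCoord; fun_prop

theorem isOpen_openBox : IsOpen openBox :=
  (isOpen_Ioo.prod isOpen_Ioo).preimage continuous_planeCoord

theorem openBox_subset_closedBox : openBox ⊆ closedBox :=
  preimage_mono (prod_mono Ioo_subset_Icc_self Ioo_subset_Icc_self)

theorem openBox_ae_eq_closedBox : openBox =ᵐ[volume] closedBox :=
  measurePreserving_planeCoord.quasiMeasurePreserving.preimage_ae_eq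
    (Measure.set_prod_ae_eq Ioo_ae_eq_Icc Ioo_ae_eq_Icc)

theorem convex_closedBox : Convex ℝ closedBox := by
  intro x hx y hy a b ha hb hab
  have h := ((convex_Icc (0 : ℝ) Real.pi).prod (convex_Icc 0 (2 * Real.pi))) hx hy ha hb hab
  simpa [closedBox, planeCoord] using h

theorem isCompact_closedBox : IsCompact closedBox := by
  have h : closedBox = (fun p : ℝ × ℝ => (!₂[p.1, p.2] : E 2)) ''
      (Icc 0 Real.pi ×ˢ Icc 0 (2 * Real.pi)) := by
    ext u
    constructor
    · intro hu
      refine ⟨planeCoord u, hu, ?_⟩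
      ext i
      fin_cases i <;> simp [planeCoord]
    · rintro ⟨p, hp, rfl⟩
      simpa [closedBox, planeCoord] using hp
  rw [h]
  exact (isCompact_Icc.prod isCompact_Icc).image
    ((PiLp.continuous_toLp 2 _).comp (by fun_prop))

section Revolution

variable {f g : ℝ → ℝ}

theorem contDiff_revolution (hf : ContDiff ℝ 1 f) (hg : ContDiff ℝ 1 g) :
    ContDiff ℝ 1 (revolution f g) := by
  rw [contDiff_euclidean]
  intro i
  fin_cases i
  · change ContDiff ℝ 1 fun u : E 2 => f (u 0) * Real.cos (u 1)
    fun_prop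
  · change ContDiff ℝ 1 fun u : E 2 => f (u 0) * Real.sin (u 1)
    fun_prop
  · change ContDiff ℝ 1 fun u : E 2 => g (u 0)
    fun_prop

theorem fderiv_revolution_apply (hf : ContDiff ℝ 1 f) (hg : ContDiff ℝ 1 g) (u w : E 2) :
    fderiv ℝ (revolution f g) u w =
      !₂[deriv f (u 0) * w 0 * Real.cos (u 1) - f (u 0) * (Real.sin (u 1) * w 1),
        deriv f (u 0) * w 0 * Real.sin (u 1) + f (u 0) * (Real.cos (u 1) * w 1),
        deriv g (u 0) * w 0] := by
  have h0 : HasFDerivAt (fun u : E 2 => u 0) (EuclideanSpace.proj 0 : E 2 →L[ℝ] ℝ) u :=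
    (EuclideanSpace.proj 0 : E 2 →L[ℝ] ℝ).hasFDerivAt
  have h1 : HasFDerivAt (fun u : E 2 => u 1) (EuclideanSpace.proj 1 : E 2 →L[ℝ] ℝ) u :=
    (EuclideanSpace.proj 1 : E 2 →L[ℝ] ℝ).hasFDerivAt
  have hd : ∀ (h : ℝ → ℝ), ContDiff ℝ 1 h →
      HasFDerivAt (fun u : E 2 => h (u 0)) (deriv h (u 0) • (EuclideanSpace.proj 0 : E 2 →L[ℝ] ℝ)) u :=
    fun h hh => ((hh.differentiable one_ne_zero (u 0)).hasDerivAt).comp_hasFDerivAt u h0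
  have hF := hasStrictFDerivAt_euclidean.1
    ((contDiff_revolution hf hg).hasStrictFDerivAt (x := u) one_ne_zero)
  have e0 := (hF 0).hasFDerivAt.unique ((hd f hf).mul h1.cos)
  have e1 := (hF 1).hasFDerivAt.unique ((hd f hf).mul h1.sin)
  have e2 := (hF 2).hasFDerivAt.unique (hd g hg)
  ext i
  fin_cases i
  · have := congr($e0 w)
    simp at this ⊢
    linear_combination this
  · have := congr($e1 w)
    simp at this ⊢
    linear_combination this
  · have := congr($e2 w)
    simpa using this

theorem inner_fderiv_revolution (hf : ContDiff ℝ 1 f) (hg : ContDiff ℝ 1 g) (u v w : E 2) :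
    ⟪fderiv ℝ (revolution f g) u v, fderiv ℝ (revolution f g) u w⟫ =
      (deriv f (u 0) ^ 2 + deriv g (u 0) ^ 2) * (v 0 * w 0) + f (u 0) ^ 2 * (v 1 * w 1) := by
  rw [fderiv_revolution_apply hf hg, fderiv_revolution_apply hf hg, PiLp.inner_apply,
    Fin.sum_univ_three]
  simp
  linear_combination (deriv f (u 0) ^ 2 * (v 0 * w 0) + f (u 0) ^ 2 * (v 1 * w 1)) *
    Real.sin_sq_add_cos_sq (u 1)

theorem injective_fderiv_revolution (hf : ContDiff ℝ 1 f) (hg : ContDiff ℝ 1 g) {u : E 2}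
    (hfu : f (u 0) ≠ 0) (hspeed : deriv f (u 0) ^ 2 + deriv g (u 0) ^ 2 ≠ 0) :
    Function.Injective (fderiv ℝ (revolution f g) u) := by
  rw [injective_iff_map_eq_zero]
  intro w hw
  have h := inner_fderiv_revolution hf hg u w w
  rw [hw, inner_zero_left] at h
  have h1 : 0 < deriv f (u 0) ^ 2 + deriv g (u 0) ^ 2 := lt_of_le_of_ne (by positivity) hspeed.symm
  have h2 : 0 < f (u 0) ^ 2 := by positivity
  have h3 := mul_nonneg h1.le (mul_self_nonneg (w 0))
  have h4 := mul_nonneg h2.le (mul_self_nonneg (w 1))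
  have h5 : w 0 * w 0 = 0 := (mul_eq_zero.1 (by linarith)).resolve_left h1.ne'
  have h6 : w 1 * w 1 = 0 := (mul_eq_zero.1 (by linarith)).resolve_left h2.ne'
  ext i
  fin_cases i
  · simpa using h5
  · simpa using h6

/-- The Gram matrix is diagonal with entries `R ^ 2` and `f (u 0) ^ 2`. -/
theorem normDet_fderiv_revolution (hf : ContDiff ℝ 1 f) (hg : ContDiff ℝ 1 g) {u : E 2} {R : ℝ}
    (hfu : 0 ≤ f (u 0)) (hR : 0 ≤ R) (hspeed : deriv f (u 0) ^ 2 + deriv g (u 0) ^ 2 = R ^ 2) :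
    (fderiv ℝ (revolution f g) u).toLinearMap.normDet = R * f (u 0) := by
  have h := (fderiv ℝ (revolution f g) u).toLinearMap.normDet_sq_eq_det_gram
    (EuclideanSpace.basisFun (Fin 2) ℝ)
  rw [Matrix.det_fin_two] at h
  simp only [Matrix.gram_apply, ContinuousLinearMap.coe_coe, inner_fderiv_revolution hf hg,
    hspeed] at h
  rw [← sq_eq_sq₀ (LinearMap.normDet_nonneg _) (mul_nonneg hR hfu)]
  simpa [mul_pow] using h

theorem lipschitzOnWith_revolution (hf : ContDiff ℝ 1 f) (hg : ContDiff ℝ 1 g) :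
    ∃ K : ℝ≥0, LipschitzOnWith K (revolution f g) closedBox := by
  have hF := contDiff_revolution hf hg
  obtain ⟨C, hC⟩ := isCompact_closedBox.exists_bound_of_continuousOn
    (hF.continuous_fderiv one_ne_zero).continuousOn
  refine ⟨C.toNNReal, convex_closedBox.lipschitzOnWith_of_nnnorm_fderiv_le (𝕜 := ℝ)
    (fun u _ => hF.differentiable one_ne_zero u) fun u hu => ?_⟩
  rw [← NNReal.coe_le_coe, coe_nnnorm]
  exact (hC u hu).trans (Real.le_coe_toNNReal C)

/-- The poles and the seam, where injectivity or immersion may fail, are the Lipschitz image of the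
null boundary of the box. -/
theorem revolution_image_ae_eq (hf : ContDiff ℝ 1 f) (hg : ContDiff ℝ 1 g) :
    revolution f g '' openBox =ᵐ[μHE[2]] revolution f g '' closedBox := by
  obtain ⟨K, hK⟩ := lipschitzOnWith_revolution hf hg
  refine (LE.le.eventuallyLE (image_mono openBox_subset_closedBox)).antisymm ?_
  rw [ae_le_set]
  refine measure_mono_null (t := revolution f g '' (closedBox \ openBox)) ?_ ?_
  · rintro _ ⟨⟨x, hx, rfl⟩, hn⟩
    exact ⟨x, ⟨hx, fun h => hn ⟨x, h, rfl⟩⟩, rfl⟩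
  have h1 := AreaFormula.euclideanHausdorffMeasure_image_le (f := revolution f g) (g := id)
    (s := closedBox \ openBox) (K := K) (fun x hx y hy => hK hx.1 hy.1) 2
  rw [image_id, EuclideanSpace.euclideanHausdorffMeasure_eq_volume,
    ae_le_set.1 openBox_ae_eq_closedBox.symm.le, mul_zero] at h1
  exact nonpos_iff_eq_zero.1 h1

theorem restrict_revolution_eq_map {R : ℝ → ℝ} (hf : ContDiff ℝ 1 f) (hg : ContDiff ℝ 1 g)
    (hfpos : ∀ t ∈ Ioo 0 Real.pi, 0 < f t) (hRpos : ∀ t ∈ Ioo 0 Real.pi, 0 < R t)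
    (hspeed : ∀ t, deriv f t ^ 2 + deriv g t ^ 2 = R t ^ 2)
    (hinj : InjOn (revolution f g) openBox) :
    (μHE[2] : Measure (E 3)).restrict (revolution f g '' closedBox) =
      Measure.map (revolution f g) ((volume.restrict openBox).withDensity
        fun u => ENNReal.ofReal (R (u 0) * f (u 0))) := by
  have hF := contDiff_revolution hf hg
  obtain ⟨K, hK⟩ := lipschitzOnWith_revolution hf hg
  rw [← Measure.restrict_congr_set (revolution_image_ae_eq hf hg)]
  have h := AreaFormula.restrict_image_eq_map_withDensity isOpen_openBox hinj
    (hK.mono openBox_subset_closedBox) (F' := fderiv ℝ (revolution f g))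
    (fun u _ => hF.hasStrictFDerivAt one_ne_zero)
    (fun u hu => injective_fderiv_revolution hf hg (hfpos _ hu.1).ne'
      (by rw [hspeed]; exact pow_ne_zero 2 (hRpos _ hu.1).ne')) hF.continuous.measurable
  rw [finrank_euclideanSpace_fin] at h
  rw [h]
  congr 1
  refine withDensity_congr_ae ((ae_restrict_iff' isOpen_openBox.measurableSet).2
    (Eventually.of_forall fun u hu => ?_))
  have hu0 : u 0 ∈ Ioo 0 Real.pi := hu.1
  simp only
  rw [normDet_fderiv_revolution hf hg (hfpos _ hu0).le (hRpos _ hu0).le (hspeed _)]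

/-- Integration of a function depending only on the parameter of the generating curve. -/
theorem integral_revolution {R : ℝ → ℝ} (hf : ContDiff ℝ 1 f) (hg : ContDiff ℝ 1 g)
    (hR : Continuous R) (hfpos : ∀ t ∈ Ioo 0 Real.pi, 0 < f t)
    (hRpos : ∀ t ∈ Ioo 0 Real.pi, 0 < R t)
    (hspeed : ∀ t, deriv f t ^ 2 + deriv g t ^ 2 = R t ^ 2)
    (hinj : InjOn (revolution f g) openBox) {h : E 3 → ℝ} {k : ℝ → ℝ} (hh : Continuous h)
    (hk : Continuous k) (hhk : ∀ u, h (revolution f g u) = k (u 0)) :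
    IntegrableOn h (revolution f g '' closedBox) μHE[2] ∧
      ∫ x in revolution f g '' closedBox, h x ∂μHE[2] =
        2 * Real.pi * ∫ t in 0..Real.pi, k t * (R t * f t) := by
  have hFm := (contDiff_revolution hf hg).continuous.measurable
  have hfc := hf.continuous
  have hJm : Measurable fun u : E 2 => ENNReal.ofReal (R (u 0) * f (u 0)) :=
    (by fun_prop : Continuous fun u : E 2 => R (u 0) * f (u 0)).measurable.ennreal_ofReal
  have hJt : ∀ᵐ u ∂(volume.restrict openBox), ENNReal.ofReal (R (u 0) * f (u 0)) < ∞ :=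
    Eventually.of_forall fun _ => ENNReal.ofReal_lt_top
  have hae : (fun u : E 2 => (ENNReal.ofReal (R (u 0) * f (u 0))).toReal •
      h (revolution f g u)) =ᵐ[volume.restrict openBox]
      fun u => k (u 0) * (R (u 0) * f (u 0)) := by
    refine (ae_restrict_iff' isOpen_openBox.measurableSet).2 (Eventually.of_forall fun u hu => ?_)
    have hu0 : u 0 ∈ Ioo 0 Real.pi := hu.1
    simp only
    rw [ENNReal.toReal_ofReal (mul_pos (hRpos _ hu0) (hfpos _ hu0)).le, hhk, smul_eq_mul,
      mul_comm]
  constructor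
  · rw [IntegrableOn, restrict_revolution_eq_map hf hg hfpos hRpos hspeed hinj,
      integrable_map_measure hh.aestronglyMeasurable hFm.aemeasurable,
      integrable_withDensity_iff_integrable_smul' hJm hJt]
    refine Integrable.congr ?_ hae.symm
    have : IntegrableOn (fun u : E 2 => k (u 0) * (R (u 0) * f (u 0))) closedBox :=
      (by fun_prop : Continuous fun u : E 2 => k (u 0) * (R (u 0) * f (u 0))).continuousOn
        |>.integrableOn_compact isCompact_closedBox
    exact this.mono_set openBox_subset_closedBox
  · rw [restrict_revolution_eq_map hf hg hfpos hRpos hspeed hinj,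
      integral_map hFm.aemeasurable hh.aestronglyMeasurable,
      integral_withDensity_eq_integral_toReal_smul hJm hJt, integral_congr_ae hae,
      setIntegral_congr_set openBox_ae_eq_closedBox, closedBox]
    have h1 := measurePreserving_planeCoord.setIntegral_preimage_emb measurableEmbedding_planeCoord
      (fun p : ℝ × ℝ => k p.1 * (R p.1 * f p.1)) (Icc 0 Real.pi ×ˢ Icc 0 (2 * Real.pi))
    refine Eq.trans h1 ?_
    rw [Measure.volume_eq_prod, setIntegral_prod]
    · simp only [integral_const, smul_eq_mul]
      rw [integral_const_mul, intervalIntegral.integral_of_le Real.pi_pos.le,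
        integral_Icc_eq_integral_Ioc]
      congr 1
      simp [Measure.real, Real.pi_pos.le]
    · exact (by fun_prop : Continuous fun p : ℝ × ℝ => k p.1 * (R p.1 * f p.1)).continuousOn
        |>.integrableOn_compact (isCompact_Icc.prod isCompact_Icc)

end Revolution

end SmallMoment

namespace SmallMoment

open Metric
open scoped RealInnerProductSpace

/-! ### Area and moments -/

theorem integral_comp_cos_mul_sin {p : ℝ → ℝ} (hp : Continuous p) :
    ∫ t in 0..Real.pi, p (Real.cos t) * Real.sin t = ∫ x in (-1 : ℝ)..1, p x := by
  have h := intervalIntegral.integral_comp_mul_deriv (a := 0) (b := Real.pi) (f := Real.cos)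
    (f' := fun t => -Real.sin t) (fun t _ => Real.hasDerivAt_cos t)
    Real.continuous_sin.neg.continuousOn hp
  rw [Real.cos_zero, Real.cos_pi, intervalIntegral.integral_symm (-1) 1] at h
  simp only [Function.comp_apply, mul_neg, intervalIntegral.integral_neg] at h
  linarith

theorem integral_sum_mul_pow (n : ℕ) (a : ℕ → ℝ) :
    ∫ x in (-1 : ℝ)..1, ∑ i ∈ Finset.range n, a i * x ^ i =
      ∑ i ∈ Finset.range n, a i * ((1 - (-1) ^ (i + 1)) / (i + 1)) := by
  rw [intervalIntegral.integral_finsetSum fun i _ =>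
    Continuous.intervalIntegrable (by fun_prop) _ _]
  simp [intervalIntegral.integral_const_mul, integral_pow]

theorem spherePoint_injOn : InjOn (fun u : E 2 => spherePoint (u 0) (u 1)) openBox := by
  intro u hu v hv h
  have hu0 : u 0 ∈ Ioo 0 Real.pi := hu.1
  have hv0 : v 0 ∈ Ioo 0 Real.pi := hv.1
  have hu1 : u 1 ∈ Ioo 0 (2 * Real.pi) := hu.2
  have hv1 : v 1 ∈ Ioo 0 (2 * Real.pi) := hv.2
  have h0 := congrArg (fun x : E 3 => x 0) h
  have h1 := congrArg (fun x : E 3 => x 1) h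
  have h2 := congrArg (fun x : E 3 => x 2) h
  simp [spherePoint] at h0 h1 h2
  have e0 : u 0 = v 0 := Real.injOn_cos (Ioo_subset_Icc_self hu0) (Ioo_subset_Icc_self hv0) h2
  have hs : Real.sin (v 0) ≠ 0 := (Real.sin_pos_of_mem_Ioo hv0).ne'
  rw [e0] at h0 h1
  have hc := mul_left_cancel₀ hs h0
  have hs' := mul_left_cancel₀ hs h1
  have h3 : Real.cos (u 1 - v 1) = 1 := by
    rw [Real.cos_sub, hc, hs']
    linarith [Real.sin_sq_add_cos_sq (v 1)]
  have e1 : u 1 - v 1 = 0 :=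
    (Real.cos_eq_one_iff_of_lt_of_lt (by linarith [hu1.1, hv1.2]) (by linarith [hu1.2, hv1.1])).1 h3
  ext i
  fin_cases i
  · exact e0
  · exact sub_eq_zero.1 e1

theorem revolution_image_closedBox (f g : ℝ → ℝ) :
    revolution f g '' closedBox = {p | ∃ t ∈ Icc 0 Real.pi, ∃ s ∈ Icc 0 (2 * Real.pi),
      p = !₂[f t * Real.cos s, f t * Real.sin s, g t]} := by
  ext p
  constructor
  · rintro ⟨u, hu, rfl⟩
    exact ⟨u 0, hu.1, u 1, hu.2, rfl⟩
  · rintro ⟨t, ht, s, hs, rfl⟩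
    exact ⟨!₂[t, s], ⟨ht, hs⟩, rfl⟩

theorem sphere_eq_revolution :
    sphere (0 : E 3) 1 = revolution Real.sin Real.cos '' closedBox := by
  rw [revolution_image_closedBox]
  ext ν
  constructor
  · exact exists_spherePoint_eq
  · rintro ⟨t, -, s, -, rfl⟩
    exact spherePoint_mem t s

theorem surface_eq_revolution : surface = revolution curveX curveY '' closedBox := by
  rw [revolution_image_closedBox, surface_eq_param]
  rfl

theorem hasDerivAt_curveX (t : ℝ) :
    HasDerivAt curveX ((9 - 8 * Real.cos (3 * t)) * Real.cos t) t := by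
  have h3 : HasDerivAt (fun t : ℝ => 3 * t) 3 t := by
    simpa using (hasDerivAt_id t).const_mul 3
  have h := (((h3.cos).add_const 9).mul (Real.hasDerivAt_sin t)).sub
    ((h3.sin.const_mul 3).mul (Real.hasDerivAt_cos t))
  refine HasDerivAt.congr_deriv (f := curveX) h ?_
  ring

theorem hasDerivAt_curveY (t : ℝ) :
    HasDerivAt curveY (-(9 - 8 * Real.cos (3 * t)) * Real.sin t) t := by
  have h3 : HasDerivAt (fun t : ℝ => 3 * t) 3 t := by
    simpa using (hasDerivAt_id t).const_mul 3
  have h := (((h3.cos).add_const 9).mul (Real.hasDerivAt_cos t)).add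
    ((h3.sin.const_mul 3).mul (Real.hasDerivAt_sin t))
  refine HasDerivAt.congr_deriv (f := curveY) h ?_
  ring

theorem integral_sphere_one :
    ∫ _ in sphere (0 : E 3) 1, (1 : ℝ) ∂μHE[2] = 4 * Real.pi := by
  rw [sphere_eq_revolution, (integral_revolution (R := fun _ => 1) (k := fun _ => 1)
    Real.contDiff_sin Real.contDiff_cos continuous_const
    (fun t ht => Real.sin_pos_of_mem_Ioo ht) (fun _ _ => one_pos)
    (fun t => by simp) spherePoint_injOn
    continuous_const continuous_const (fun _ => rfl)).2]
  simp
  ring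

theorem integral_surface {h : E 3 → ℝ} {p : ℝ → ℝ} (hh : Continuous h) (hp : Continuous p)
    (hhp : ∀ u, h (revolution curveX curveY u) = p (Real.cos (u 0))) :
    IntegrableOn h surface μHE[2] ∧ ∫ x in surface, h x ∂μHE[2] =
      2 * Real.pi * ∫ x in (-1 : ℝ)..1, p x * ((9 + 24 * x - 32 * x ^ 3) * (9 - 8 * x ^ 3)) := by
  have hinj : InjOn (revolution curveX curveY) openBox := by
    -- Injectivity is inherited from polar coordinates on the sphere, through the injective inverse
    -- Gauss map.
    intro u hu v hv huv
    refine spherePoint_injOn hu hv (injOn_boundaryPoint norm_axis₃ (spherePoint_mem _ _)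
      (spherePoint_mem _ _) ?_)
    rw [← param_eq, ← param_eq]
    exact huv
  have hX : ContDiff ℝ 1 curveX := by unfold curveX; fun_prop
  have hY : ContDiff ℝ 1 curveY := by unfold curveY; fun_prop
  obtain ⟨h1, h2⟩ := integral_revolution (R := fun t => 9 - 8 * Real.cos (3 * t)) hX hY
    (by fun_prop)
    (fun t ht => by
      rw [curveX_eq]
      exact mul_pos (curvature_radius_pos t).2 (Real.sin_pos_of_mem_Ioo ht))
    (fun t _ => (curvature_radius_pos t).1)
    (fun t => by
      rw [(hasDerivAt_curveX t).deriv, (hasDerivAt_curveY t).deriv]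
      linear_combination (9 - 8 * Real.cos (3 * t)) ^ 2 * Real.sin_sq_add_cos_sq t)
    hinj hh (hp.comp Real.continuous_cos) hhp
  rw [surface_eq_revolution]
  refine ⟨h1, h2.trans ?_⟩
  rw [← integral_comp_cos_mul_sin (by fun_prop)]
  congr 2
  ext t
  simp only [Function.comp_apply, curveX_eq, Real.cos_three_mul]
  ring

theorem norm_revolution_sq (u : E 2) :
    ‖revolution curveX curveY u‖ ^ 2 =
      90 - 54 * Real.cos (u 0) - 72 * Real.cos (u 0) ^ 2 + 72 * Real.cos (u 0) ^ 3 +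
        192 * Real.cos (u 0) ^ 4 - 128 * Real.cos (u 0) ^ 6 := by
  have h1 : ‖revolution curveX curveY u‖ ^ 2 = curveX (u 0) ^ 2 + curveY (u 0) ^ 2 := by
    rw [EuclideanSpace.real_norm_sq_eq, Fin.sum_univ_three]
    simp [revolution]
    linear_combination curveX (u 0) ^ 2 * Real.sin_sq_add_cos_sq (u 1)
  rw [h1, curveX_eq, curveY_eq]
  linear_combination (9 - 8 * Real.cos (u 0) ^ 3) ^ 2 * Real.sin_sq_add_cos_sq (u 0)

theorem integral_surface_one :
    ∫ _ in surface, (1 : ℝ) ∂μHE[2] = 11084 * Real.pi / 35 := by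
  rw [(integral_surface (p := fun _ => 1) continuous_const continuous_const fun _ => rfl).2]
  -- The list holds all seven coefficients, so the default 0 of `getD` is never used.
  have h : ∀ x : ℝ, 1 * ((9 + 24 * x - 32 * x ^ 3) * (9 - 8 * x ^ 3)) =
      ∑ i ∈ Finset.range 7, [81, 216, 0, -360, -192, 0, 256].getD i 0 * x ^ i := by
    intro x
    simp [Finset.sum_range_succ]
    ring
  simp only [h]
  rw [integral_sum_mul_pow]
  simp [Finset.sum_range_succ]
  ring

theorem integral_surface_norm_sq :
    IntegrableOn (fun x : E 3 => ‖x‖ ^ 2) surface μHE[2] ∧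
      ∫ x in surface, ‖x‖ ^ 2 ∂μHE[2] = 124744936 * Real.pi / 5005 := by
  obtain ⟨h1, h2⟩ := integral_surface (h := fun x : E 3 => ‖x‖ ^ 2)
    (p := fun x => 90 - 54 * x - 72 * x ^ 2 + 72 * x ^ 3 + 192 * x ^ 4 - 128 * x ^ 6)
    (by fun_prop) (by fun_prop) norm_revolution_sq
  refine ⟨h1, h2.trans ?_⟩
  have h : ∀ x : ℝ, (90 - 54 * x - 72 * x ^ 2 + 72 * x ^ 3 + 192 * x ^ 4 - 128 * x ^ 6) *
      ((9 + 24 * x - 32 * x ^ 3) * (9 - 8 * x ^ 3)) =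
      ∑ i ∈ Finset.range 13, [7290, 15066, -17496, -42120, 33264, 77760, 576, -124416, -55296,
        64512, 73728, 0, -32768].getD i 0 * x ^ i := by
    intro x
    simp [Finset.sum_range_succ]
    ring
  simp only [h]
  rw [integral_sum_mul_pow]
  simp [Finset.sum_range_succ]
  ring

theorem integrableOn_surface_norm : IntegrableOn (fun x : E 3 => ‖x‖) surface μHE[2] := by
  refine (integral_surface (p := fun x => √(90 - 54 * x - 72 * x ^ 2 + 72 * x ^ 3 + 192 * x ^ 4 -
    128 * x ^ 6)) continuous_norm (by fun_prop) fun u => ?_).1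
  rw [← norm_revolution_sq, Real.sqrt_sq (norm_nonneg _)]

theorem area_eq_integral_one (n : ℕ) (S : Set (E n)) :
    area n S = ∫ _ in S, (1 : ℝ) ∂μHE[n - 1] := by
  simp [area, Measure.real]

theorem area_surface : area 3 surface = 11084 * Real.pi / 35 :=
  (area_eq_integral_one 3 surface).trans integral_surface_one

theorem unitSphereArea_three : unitSphereArea 3 = 4 * Real.pi :=
  (area_eq_integral_one 3 _).trans integral_sphere_one

theorem polarMoment_surface : polarMoment 3 surface = 124744936 * Real.pi / 5005 :=
  integral_surface_norm_sq.2

/-! ### Failure of the two inequalities -/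

/-- Cauchy–Schwarz, obtained from `0 ≤ ∫ (r - c)²` with `c` the mean of `r` over the surface. -/
theorem firstMoment_surface_sq_le :
    firstMoment 3 surface ^ 2 ≤ area 3 surface * polarMoment 3 surface := by
  have hA : 0 < area 3 surface := by rw [area_surface]; positivity
  have h1 : IntegrableOn (fun _ : E 3 => (1 : ℝ)) surface μHE[2] :=
    (integral_surface (p := fun _ => 1) continuous_const continuous_const fun _ => rfl).1
  have key : ∀ c : ℝ,
      0 ≤ polarMoment 3 surface - 2 * c * firstMoment 3 surface + c ^ 2 * area 3 surface := by
    intro c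
    have h2 : (0 : ℝ) ≤ ∫ x in surface, (‖x‖ - c) ^ 2 ∂μHE[2] :=
      integral_nonneg fun x => sq_nonneg _
    have h3 : ∀ x : E 3, (‖x‖ - c) ^ 2 = ‖x‖ ^ 2 - 2 * c * ‖x‖ + c ^ 2 * 1 := fun x => by ring
    simp only [h3] at h2
    have h4 : IntegrableOn (fun x : E 3 => ‖x‖ ^ 2 - 2 * c * ‖x‖) surface μHE[2] :=
      integral_surface_norm_sq.1.sub (integrableOn_surface_norm.const_mul _)
    rw [integral_add h4 (h1.const_mul _), integral_sub integral_surface_norm_sq.1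
      (integrableOn_surface_norm.const_mul _), integral_const_mul, integral_const_mul] at h2
    rw [area_eq_integral_one]
    exact h2
  have h := key (firstMoment 3 surface / area 3 surface)
  have h4 : polarMoment 3 surface - 2 * (firstMoment 3 surface / area 3 surface) *
      firstMoment 3 surface + (firstMoment 3 surface / area 3 surface) ^ 2 * area 3 surface =
      polarMoment 3 surface - firstMoment 3 surface ^ 2 / area 3 surface := by
    field_simp
    ring
  rw [h4, sub_nonneg, div_le_iff₀ hA] at h
  linarith

theorem polarMoment_surface_lt :
    polarMoment 3 surface < area 3 surface ^ 2 / unitSphereArea 3 := by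
  rw [polarMoment_surface, area_surface, unitSphereArea_three]
  have hpi := Real.pi_pos
  rw [lt_div_iff₀ (by positivity)]
  nlinarith [sq_pos_of_pos hpi]

theorem not_polarMomentInequality_surface : ¬ PolarMomentInequality 3 surface := by
  unfold PolarMomentInequality
  have hω : 0 < unitSphereArea 3 := by rw [unitSphereArea_three]; positivity
  have h := polarMoment_surface_lt
  rw [show (((3 : ℕ) : ℝ) + 1) / (((3 : ℕ) : ℝ) - 1) = (2 : ℕ) by norm_num, Real.rpow_natCast]
  have h2 : unitSphereArea 3 * (area 3 surface / unitSphereArea 3) ^ 2 =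
      area 3 surface ^ 2 / unitSphereArea 3 := by
    field_simp
  rw [h2]
  exact not_le.2 h

/-- Squaring removes the exponent `3/2`: inequality (3) would give `|Σ|³/ω ≤ (∫ r)² ≤ |Σ| ∫ r²`,
contradicting the strict bound on the polar moment. -/
theorem not_firstMomentInequality_surface : ¬ FirstMomentInequality 3 surface := by
  unfold FirstMomentInequality
  intro h
  have hω : 0 < unitSphereArea 3 := by rw [unitSphereArea_three]; positivity
  have hA : 0 < area 3 surface := by rw [area_surface]; positivity
  set x := area 3 surface / unitSphereArea 3 with hx
  have hx0 : 0 < x := div_pos hA hω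
  have h1 : (x ^ (((3 : ℕ) : ℝ) / (((3 : ℕ) : ℝ) - 1))) ^ 2 = x ^ 3 := by
    rw [← Real.rpow_natCast, ← Real.rpow_mul hx0.le, ← Real.rpow_natCast]
    norm_num
  have h2 : (unitSphereArea 3 * x ^ (((3 : ℕ) : ℝ) / (((3 : ℕ) : ℝ) - 1))) ^ 2 ≤
      firstMoment 3 surface ^ 2 :=
    pow_le_pow_left₀ (by positivity) h 2
  rw [mul_pow, h1] at h2
  have h3 : unitSphereArea 3 ^ 2 * x ^ 3 =
      area 3 surface * (area 3 surface ^ 2 / unitSphereArea 3) := by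
    rw [hx]; field_simp
  have h4 := mul_lt_mul_of_pos_left polarMoment_surface_lt hA
  linarith [firstMoment_surface_sq_le]

end SmallMoment

theorem mainTheorem9 :
    -- the generating curve has constant width
    SmallMoment.IsConstantWidthCurve SmallMoment.curve 18 ∧
    -- the surface: explicit description, closed, connected, analytic, embedded, star-shaped
    SmallMoment.surface =
      {p | ∃ t ∈ Set.Icc 0 Real.pi, ∃ s ∈ Set.Icc 0 (2 * Real.pi), p = SmallMoment.param t s} ∧
    IsCompact SmallMoment.surface ∧ IsConnected SmallMoment.surface ∧
    SmallMoment.IsAnalyticSurface SmallMoment.surface ∧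
    SmallMoment.IsStarShaped SmallMoment.surface ∧
    -- it bounds a strictly convex body, and its principal curvatures with respect to the outward
    -- unit normal are the given ones and lie in `[1/17, 1]`
    (∃ (K : Set (SmallMoment.E 3)) (N : SmallMoment.E 3 → SmallMoment.E 3),
      IsCompact K ∧ StrictConvex ℝ K ∧ (interior K).Nonempty ∧
      frontier K = SmallMoment.surface ∧ SmallMoment.IsOutwardUnitNormal K N ∧
      (∀ t ∈ Set.Icc 0 Real.pi, ∀ s : ℝ, ∃ e₁ e₂ : SmallMoment.E 3,
        ‖e₁‖ = 1 ∧ ‖e₂‖ = 1 ∧ inner ℝ e₁ e₂ = 0 ∧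
        SmallMoment.IsPrincipal SmallMoment.surface N (SmallMoment.param t s)
          (SmallMoment.kappa₁ t) e₁ ∧
        SmallMoment.IsPrincipal SmallMoment.surface N (SmallMoment.param t s)
          (SmallMoment.kappa₂ t) e₂) ∧
      (∀ p ∈ SmallMoment.surface, ∀ (κ : ℝ) (v : SmallMoment.E 3),
        SmallMoment.IsPrincipal SmallMoment.surface N p κ v → 1 / 17 ≤ κ ∧ κ ≤ 1)) ∧
    -- area and polar moment of inertia
    MeasureTheory.IntegrableOn (fun x : SmallMoment.E 3 => ‖x‖) SmallMoment.surface μHE[2] ∧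
    MeasureTheory.IntegrableOn (fun x : SmallMoment.E 3 => ‖x‖ ^ 2) SmallMoment.surface μHE[2] ∧
    SmallMoment.area 3 SmallMoment.surface ^ 2 = 122855056 * Real.pi ^ 2 / 1225 ∧
    SmallMoment.polarMoment 3 SmallMoment.surface = 124744936 * Real.pi / 5005 ∧
    (SmallMoment.area 3 SmallMoment.surface ^ 2)⁻¹ * SmallMoment.polarMoment 3 SmallMoment.surface =
      545759095 / (2196034126 * Real.pi) ∧
    (SmallMoment.area 3 SmallMoment.surface ^ 2)⁻¹ * SmallMoment.polarMoment 3 SmallMoment.surface <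
      1 / (4 * Real.pi) ∧
    SmallMoment.unitSphereArea 3 = 4 * Real.pi ∧
    -- the two inequalities fail
    ¬ SmallMoment.FirstMomentInequality 3 SmallMoment.surface ∧
    ¬ SmallMoment.PolarMomentInequality 3 SmallMoment.surface := by
  have he := SmallMoment.norm_axis₃
  have hS := SmallMoment.surface_eq
  have hF := (SmallMoment.frontier_body he).trans hS.symm
  have h0 := SmallMoment.zero_mem_interior_body he
  have hratio : (SmallMoment.area 3 SmallMoment.surface ^ 2)⁻¹ *
      SmallMoment.polarMoment 3 SmallMoment.surface = 545759095 / (2196034126 * Real.pi) := by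
    rw [SmallMoment.area_surface, SmallMoment.polarMoment_surface]
    field_simp
    norm_num
  refine ⟨SmallMoment.isConstantWidthCurve_curve, SmallMoment.surface_eq_param, ?_, ?_, ?_, ?_, ?_,
    SmallMoment.integrableOn_surface_norm, SmallMoment.integral_surface_norm_sq.1, ?_,
    SmallMoment.polarMoment_surface, hratio, ?_, SmallMoment.unitSphereArea_three,
    SmallMoment.not_firstMomentInequality_surface, SmallMoment.not_polarMomentInequality_surface⟩
  · rw [hS]
    exact (isCompact_sphere _ _).image (SmallMoment.continuous_boundaryPoint _)
  · rw [hS]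
    exact SmallMoment.isConnected_boundaryPoint_image _
  · rw [hS]
    exact SmallMoment.isAnalyticSurface_boundaryPoint_image he
  · rw [← hF]
    exact SmallMoment.isStarShaped_frontier (SmallMoment.isCompact_body he)
      (SmallMoment.convex_body _) h0
  · refine ⟨SmallMoment.body SmallMoment.axis₃, SmallMoment.gaussMap SmallMoment.axis₃,
      SmallMoment.isCompact_body he, SmallMoment.strictConvex_body he, ⟨0, h0⟩, hF,
      SmallMoment.isOutwardUnitNormal_gaussMap he,
      fun t _ s => SmallMoment.exists_principal_directions t s, ?_⟩
    rw [hS]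
    intro p hp κ v h
    exact SmallMoment.isPrincipal_gaussMap_bounds he hp h
  · rw [SmallMoment.area_surface]
    ring
  · rw [hratio, div_lt_div_iff₀ (by positivity) (by positivity)]
    linarith [Real.pi_pos]
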